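/- Let $n>1$ be an integer, let $S=\operatorname{Spec}\mathbb Z[z_i,(z_i-z_j)^{-1},\,1\le i\ne j\le n]$, and let $x$ be the coordinate on $\mathbb A^1\subset\mathbb P^1$. Put $P=\prod_{i=1}^n(x-z_i)$ and $\eta=dP/P$, and let $T\subset\mathbb P^1_S$ be the union of the disjoint sections $x=z_1,\dots,x=z_n$, $x=\infty$. Let $\mathcal P^h$ be the logarithmic local system $\mathcal O_{\mathbb P^1_S}[h,h^{-1}]$ with the connection $\nabla(f)=df+hf\eta$, with logarithmic poles along $T$, and let $$E=H^1_{dR,\log}(\mathbb P^1_S/S,\mathcal P^h)$$ be its first relative logarithmic de Rham cohomology (the hypercohomology of $\mathcal O_{\mathbb P^1_S}[h,h^{-1}]\xrightarrow{\nabla}\Omega^1_{\mathbb P^1_S/S}(\log T)[h,h^{-1}]$), equipped with the Gauss–Manin connection. For a prime $p$ let $$E^\flat=E\otimes_{\mathbb Z[h]}\mathbb F_p[h,(h^p-h)^{-1}]$$ with the induced connection, which is linear over $\mathbb F_p[h,(h^p-h)^{-1}]$. **Theorem.** If $p$ does not divide $n$, then $H^m_{dR}(S,E^\flat)=0$ for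 every integer $m\ge 0$, where $H^\bullet_{dR}(S,E^\flat)$ is the cohomology of the de Rham complex $E^\flat\to\Omega^1_S\otimes E^\flat\to\Omega^2_S\otimes E^\flat\to\cdots$ of global sections on the affine scheme $S$. In particular, $E^\flat$ has no non-zero flat sections. -/

import Mathlib

open Polynomial

noncomputable section

/-! ### Extending derivations to the fraction field -/

theorem isUnit_algebraMap_end {A : Type*} [CommRing A] [IsDomain A] (s : nonZeroDivisors A) :
    IsUnit (algebraMap A (Module.End A (FractionRing A)) s) := by
  have hs : IsUnit (algebraMap A (FractionRing A) s) := IsLocalization.map_units _ s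
  rw [Module.End.isUnit_iff]
  constructor
  · intro a b hab
    simp only [Module.algebraMap_end_apply, Algebra.smul_def] at hab
    exact hs.mul_left_cancel hab
  · intro b
    obtain ⟨u, hu⟩ := hs
    refine ⟨(↑u⁻¹ : FractionRing A) * b, ?_⟩
    simp only [Module.algebraMap_end_apply, Algebra.smul_def, ← hu, ← mul_assoc,
      Units.mul_inv, one_mul]

/-- The unique extension of a derivation `D` of a domain `A` to its field of fractions. -/
def fracDerivation {R A : Type*} [CommRing R] [CommRing A] [IsDomain A] [Algebra R A]
    (D : Derivation R A A) : Derivation R (FractionRing A) (FractionRing A) :=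
  (LinearMap.extendScalarsOfIsLocalization (nonZeroDivisors A) (FractionRing A)
    (IsLocalizedModule.lift (nonZeroDivisors A) (KaehlerDifferential.map R R A (FractionRing A))
      ((Algebra.linearMap A (FractionRing A)).compDer D).liftKaehlerDifferential
      (isUnit_algebraMap_end (A := A)))).compDer (KaehlerDifferential.D R (FractionRing A))

theorem fracDerivation_algebraMap {R A : Type*} [CommRing R] [CommRing A] [IsDomain A]
    [Algebra R A] (D : Derivation R A A) (a : A) :
    fracDerivation D (algebraMap A (FractionRing A) a) = algebraMap A (FractionRing A) (D a) := by
  have h0 : KaehlerDifferential.D R (FractionRing A) (algebraMap A (FractionRing A) a) =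
      KaehlerDifferential.map R R A (FractionRing A) (KaehlerDifferential.D R A a) := by simp
  change (IsLocalizedModule.lift (nonZeroDivisors A)
    (KaehlerDifferential.map R R A (FractionRing A))
    ((Algebra.linearMap A (FractionRing A)).compDer D).liftKaehlerDifferential
    (isUnit_algebraMap_end (A := A))) (KaehlerDifferential.D R
      (FractionRing A) (algebraMap A (FractionRing A) a)) = _
  rw [h0, IsLocalizedModule.lift_apply]
  simp

theorem derivation_fractionRing_eq_zero {R A : Type*} [CommRing R] [CommRing A] [IsDomain A]
    [Algebra R A] (D : Derivation R (FractionRing A) (FractionRing A))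
    (hD : ∀ a : A, D (algebraMap A (FractionRing A) a) = 0) (f : FractionRing A) : D f = 0 := by
  obtain ⟨a, b, hb, rfl⟩ := IsFractionRing.div_surjective (A := A) f
  rw [Derivation.leibniz_div, hD, hD]
  simp

/-- A derivation that maps the generators of a subalgebra into it preserves the subalgebra. -/
theorem derivation_mem_adjoin {R K : Type*} [CommRing R] [CommRing K] [Algebra R K]
    (D : Derivation R K K) (s : Set K) (hs : ∀ f ∈ s, D f ∈ Algebra.adjoin R s)
    {f : K} (hf : f ∈ Algebra.adjoin R s) : D f ∈ Algebra.adjoin R s := by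
  induction hf using Algebra.adjoin_induction with
  | mem f hf => exact hs f hf
  | algebraMap r => simp
  | add f g _ _ hf hg => rw [map_add]; exact add_mem hf hg
  | mul f g hf' hg' hf hg =>
    rw [Derivation.leibniz, smul_eq_mul, smul_eq_mul]
    exact add_mem (mul_mem hf' hg) (mul_mem hg' hf)

namespace LogLocalSystem

/-! ### Functions on the open pieces of the projective line over `S`

Everything takes place inside the field `K n` of rational functions in `h, z_1, …, z_n, x` over
the integers.  Constants are the elements of `ℤ[h]`, here `ℤ[X]`.  -/

/-- The field of rational functions in `z_1, …, z_n` (the variables `some i`), `x` (the variable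
`none`) and `h` (the variable of the coefficient ring `ℤ[X]`). -/
abbrev K (n : ℕ) : Type := FractionRing (MvPolynomial (Option (Fin n)) ℤ[X])

variable {n : ℕ}

/-- The coordinate `z_i` on `S`. -/
def z (i : Fin n) : K n := algebraMap (MvPolynomial (Option (Fin n)) ℤ[X]) (K n) (.X (some i))

variable (n) in
/-- The coordinate `x` on the affine line. -/
def x : K n := algebraMap (MvPolynomial (Option (Fin n)) ℤ[X]) (K n) (.X none)

variable (n) in
/-- The parameter `h`. -/
def h : K n := algebraMap ℤ[X] (K n) X

/-- The `ℤ[h]`-linear derivation `∂/∂z_i` (it kills `x`, `h` and `z_j` for `j ≠ i`). -/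
def dz (i : Fin n) : Derivation ℤ[X] (K n) (K n) := fracDerivation (MvPolynomial.pderiv (some i))

variable (n) in
/-- The `ℤ[h]`-linear derivation `∂/∂x` (it kills `h` and all `z_i`). -/
def dx : Derivation ℤ[X] (K n) (K n) := fracDerivation (MvPolynomial.pderiv none)

variable (n) in
/-- The polynomial `P = ∏ (x - z_i)`. -/
def P : K n := ∏ i, (x n - z i)

variable (n) in
/-- Generators of the ring `ℤ[h, h⁻¹, z_i, (z_i - z_j)⁻¹]`, that is, of `O(S)[h, h⁻¹]`. -/
def gensS : Set (K n) :=
  {(h n)⁻¹} ∪ Set.range z ∪ {f | ∃ i j : Fin n, i ≠ j ∧ f = (z i - z j)⁻¹}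

variable (n) in
/-- The functions `(x - z_i)⁻¹`. -/
def poles : Set (K n) := Set.range fun i : Fin n => (x n - z i)⁻¹

variable (n) in
/-- `O(𝔸¹_S)[h, h⁻¹]`: the functions regular on the complement of the section at infinity. -/
def OA : Subalgebra ℤ[X] (K n) := Algebra.adjoin ℤ[X] (gensS n ∪ {x n})

variable (n) in
/-- `O(V)[h, h⁻¹]`, where `V` is the complement in `ℙ¹_S` of the sections `x = z_1, …, x = z_n`
(a neighbourhood of infinity, affine over `S`). -/
def OV : Subalgebra ℤ[X] (K n) := Algebra.adjoin ℤ[X] (gensS n ∪ poles n)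

variable (n) in
/-- `O(U)[h, h⁻¹]`, where `U` is the intersection of `𝔸¹_S` and `V`. -/
def OU : Subalgebra ℤ[X] (K n) := Algebra.adjoin ℤ[X] (gensS n ∪ ({x n} ∪ poles n))

/-! ### The relative logarithmic de Rham complex of `P^h`

A relative `1`-form `f dx` is represented by its coefficient `f`.  -/

variable (n) in
/-- Relative `1`-forms on `𝔸¹_S` with logarithmic poles along the divisors `x = z_i`:
the forms `f dx` such that `P f dx` is regular on `𝔸¹_S`. -/
def logFormsA : Submodule ℤ[X] (K n) :=
  (Subalgebra.toSubmodule (OA n)).comap (LinearMap.mulLeft ℤ[X] (P n))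

variable (n) in
/-- Relative `1`-forms on `V` with logarithmic poles along the section at infinity.  In the local
coordinate `t = x⁻¹` one has `f dx = - x f dt / t`, so the condition is that `f` be regular on `V`
and that `x f` be regular on `V`. -/
def logFormsV : Submodule ℤ[X] (K n) :=
  Subalgebra.toSubmodule (OV n) ⊓
    (Subalgebra.toSubmodule (OV n)).comap (LinearMap.mulLeft ℤ[X] (x n))

/-- The covariant derivative `∇_v f = v f + h (v P / P) f` of `P^h` along a vector field `v`;
that is, the contraction of `df + h f dP/P` with `v`. -/
def cov (v : Derivation ℤ[X] (K n) (K n)) : K n →ₗ[ℤ[X]] K n :=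
  (v : K n →ₗ[ℤ[X]] K n) + LinearMap.mulLeft ℤ[X] (h n * (v (P n) / P n))

variable (n) in
/-- The differential `f ↦ df + h f dP/P` of the relative de Rham complex of `P^h`, where relative
forms `g dx` are represented by `g`. -/
def relNabla : K n →ₗ[ℤ[X]] K n := cov (dx n)

variable (n) in
/-- The `1`-cocycles of the total Čech complex, for the open cover of `ℙ¹_S` by `𝔸¹_S` and `V`, of
the relative logarithmic de Rham complex of `P^h`: triples `(a, b, c)` that consist of logarithmic
forms `a dx` on `𝔸¹_S` and `b dx` on `V` and a function `c` on `U` with `b dx - a dx = ∇ c`. -/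
def cocycles : Submodule ℤ[X] (K n × K n × K n) where
  carrier := {w | w.1 ∈ logFormsA n ∧ w.2.1 ∈ logFormsV n ∧ w.2.2 ∈ OU n ∧
    w.2.1 - w.1 = relNabla n w.2.2}
  add_mem' {v w} hv hw := by
    refine ⟨add_mem hv.1 hw.1, add_mem hv.2.1 hw.2.1, add_mem hv.2.2.1 hw.2.2.1, ?_⟩
    simp only [Prod.fst_add, Prod.snd_add, map_add, ← hv.2.2.2, ← hw.2.2.2]
    ring
  zero_mem' := by simp
  smul_mem' c w hw := by
    refine ⟨Submodule.smul_mem _ c hw.1, Submodule.smul_mem _ c hw.2.1,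
      (OU n).smul_mem hw.2.2.1 c, ?_⟩
    simp only [Prod.smul_fst, Prod.smul_snd, map_smul, ← hw.2.2.2, smul_sub]

variable (n) in
/-- The first differential `(f, g) ↦ (∇ f, ∇ g, g - f)` of the total Čech complex. -/
def cechD : K n × K n →ₗ[ℤ[X]] K n × K n × K n :=
  ((relNabla n).comp (LinearMap.fst ..)).prod
    (((relNabla n).comp (LinearMap.snd ..)).prod (LinearMap.snd .. - LinearMap.fst ..))

variable (n) in
/-- The `1`-coboundaries of the total Čech complex: the triples `(∇ f, ∇ g, g - f)` with `f` a
function on `𝔸¹_S` and `g` a function on `V`. -/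
def coboundaries : Submodule ℤ[X] (K n × K n × K n) :=
  ((Subalgebra.toSubmodule (OA n)).prod (Subalgebra.toSubmodule (OV n))).map (cechD n)

variable (n) in
/-- `E = H¹_{dR,log}(ℙ¹_S / S, P^h)`, the first hypercohomology of the relative logarithmic de Rham
complex of `P^h`, computed by the Čech complex of the cover of `ℙ¹_S` by `𝔸¹_S` and `V`. -/
abbrev E : Type := cocycles n ⧸ (coboundaries n).submoduleOf (cocycles n)

/-! ### The Gauss–Manin connection

The connection along `∂/∂z_i` is given by the Čech formula: choose on every open set of the cover a
logarithmic vector field that lifts `∂/∂z_i`; a cocycle `(a, b, c)` is mapped to the Lie derivatives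
of its entries, corrected by the contraction of `a` with the difference of the two lifts.  On `V` the
lift is `∂/∂z_i` itself, on `𝔸¹_S` it is `∂/∂z_i + g_i ∂/∂x`, where `g_i` is the Lagrange
interpolation polynomial with `g_i(z_j) = δ_ij`, so that the lift is tangent to all divisors
`x = z_j`.  -/

/-- The Lagrange interpolation polynomial `g_i = ∏_{j ≠ i} (x - z_j)/(z_i - z_j)`. -/
def lagr (i : Fin n) : K n := ∏ j ∈ Finset.univ.erase i, (x n - z j) / (z i - z j)

/-- The lift `∂/∂z_i + g_i ∂/∂x` of `∂/∂z_i` to a logarithmic vector field on `𝔸¹_S`. -/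
def liftA (i : Fin n) : Derivation ℤ[X] (K n) (K n) := dz i + lagr i • dx n

/-- The Lie derivative on relative `1`-forms with values in `P^h` along a lift `v` of a vector field
on `S`: `f dx ↦ (∇_v f) dx + f d(v x)`, with `d(v x) = ∂(v x)/∂x dx`. -/
def lieForm (v : Derivation ℤ[X] (K n) (K n)) : K n →ₗ[ℤ[X]] K n :=
  cov v + LinearMap.mulLeft ℤ[X] (dx n (v (x n)))

/-- The operator on triples that induces the Gauss–Manin connection along `∂/∂z_i`:
`(a, b, c) ↦ (L_v a, L_w b, ∇_w c + ⟨w - v, a⟩)` with `v = ∂/∂z_i + g_i ∂/∂x`, `w = ∂/∂z_i`, for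
which the contraction of `a dx` with `w - v` is `- g_i a`. -/
def gmCech (i : Fin n) : K n × K n × K n →ₗ[ℤ[X]] K n × K n × K n :=
  ((lieForm (liftA i)).comp (LinearMap.fst ..)).prod
    (((lieForm (dz i)).comp ((LinearMap.fst ..).comp (LinearMap.snd ..))).prod
      ((cov (dz i)).comp ((LinearMap.snd ..).comp (LinearMap.snd ..)) -
        (LinearMap.mulLeft ℤ[X] (lagr i)).comp (LinearMap.fst ..)))

/-! Facts needed for the operator to descend to `E`. -/

theorem z_injective : Function.Injective (z (n := n)) := by
  intro i j hij
  have := MvPolynomial.X_injective (IsFractionRing.injective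
    (MvPolynomial (Option (Fin n)) ℤ[X]) (K n) hij)
  simpa using this

theorem x_sub_z_ne_zero (i : Fin n) : x n - z i ≠ 0 := by
  intro hi
  have := MvPolynomial.X_injective (IsFractionRing.injective
    (MvPolynomial (Option (Fin n)) ℤ[X]) (K n) (sub_eq_zero.1 hi))
  simp at this

theorem z_sub_z_ne_zero {i j : Fin n} (hij : i ≠ j) : z i - z j ≠ 0 :=
  fun hz => hij (z_injective (sub_eq_zero.1 hz))

theorem P_ne_zero : P n ≠ 0 := Finset.prod_ne_zero_iff.2 fun i _ => x_sub_z_ne_zero i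

@[simp] theorem dx_x : dx n (x n) = 1 := by
  simp [dx, x, fracDerivation_algebraMap]

@[simp] theorem dx_z (i : Fin n) : dx n (z i) = 0 := by
  simp [dx, z, fracDerivation_algebraMap, MvPolynomial.pderiv_X]

@[simp] theorem dz_x (i : Fin n) : dz i (x n) = 0 := by
  simp [dz, x, fracDerivation_algebraMap, MvPolynomial.pderiv_X]

theorem dz_z (i j : Fin n) : dz i (z j) = if j = i then 1 else 0 := by
  by_cases hij : j = i
  · subst hij; simp [dz, z, fracDerivation_algebraMap]
  · simp [dz, z, fracDerivation_algebraMap, MvPolynomial.pderiv_X, hij]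

@[simp] theorem derivation_h (v : Derivation ℤ[X] (K n) (K n)) : v (h n) = 0 := by
  simp [h]

theorem dz_dx_comm (i : Fin n) (f : K n) : dz i (dx n f) = dx n (dz i f) := by
  have h0 := derivation_fractionRing_eq_zero (R := ℤ[X])
    (A := MvPolynomial (Option (Fin n)) ℤ[X]) ⁅dz i, dx n⁆ (fun a => by
    rw [Derivation.commutator_apply]
    simp only [dz, dx, fracDerivation_algebraMap]
    rw [← map_sub, ← Derivation.commutator_apply]
    have e : ∀ D D' : Derivation ℤ[X] (MvPolynomial (Option (Fin n)) ℤ[X])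
        (MvPolynomial (Option (Fin n)) ℤ[X]), (∀ j, ⁅D, D'⁆ (.X j) = 0) → ⁅D, D'⁆ = 0 :=
      fun D D' hD => MvPolynomial.derivation_ext hD
    rw [e _ _ fun j => ?_]
    · simp
    · rw [Derivation.commutator_apply]
      simp only [MvPolynomial.pderiv_X, Pi.single_apply]
      split_ifs <;> simp) f
  rw [Derivation.commutator_apply] at h0
  exact sub_eq_zero.1 h0

theorem x_mem_OA : x n ∈ OA n := Algebra.subset_adjoin (by simp)

theorem gensS_mem {f : K n} (t : Set (K n)) (hf : f ∈ gensS n) :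
    f ∈ Algebra.adjoin ℤ[X] (gensS n ∪ t) := Algebra.subset_adjoin (Or.inl hf)

theorem z_mem_gensS (i : Fin n) : z i ∈ gensS n := Or.inl (Or.inr ⟨i, rfl⟩)

theorem inv_mem_gensS {i j : Fin n} (hij : i ≠ j) : (z i - z j)⁻¹ ∈ gensS n :=
  Or.inr ⟨i, j, hij, rfl⟩

theorem h_mem (s : Subalgebra ℤ[X] (K n)) : h n ∈ s := s.algebraMap_mem _

theorem inv_mem_OV (i : Fin n) : (x n - z i)⁻¹ ∈ OV n := Algebra.subset_adjoin (Or.inr ⟨i, rfl⟩)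

theorem OA_le_OU : OA n ≤ OU n := Algebra.adjoin_mono (by grind)

theorem OV_le_OU : OV n ≤ OU n := Algebra.adjoin_mono (by grind)

/-- A derivation that maps the `z_i` to constants preserves the ring generated over `O(S)[h, h⁻¹]`
by a set `t` that it maps into this ring. -/
theorem derivation_mem (v : Derivation ℤ[X] (K n) (K n)) (t : Set (K n))
    (hz : ∀ i, v (z i) ∈ Algebra.adjoin ℤ[X] (gensS n ∪ t))
    (ht : ∀ f ∈ t, v f ∈ Algebra.adjoin ℤ[X] (gensS n ∪ t)) {f : K n}
    (hf : f ∈ Algebra.adjoin ℤ[X] (gensS n ∪ t)) : v f ∈ Algebra.adjoin ℤ[X] (gensS n ∪ t) := by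
  refine derivation_mem_adjoin v _ ?_ hf
  rintro f (((hf | ⟨i, rfl⟩) | ⟨i, j, hij, rfl⟩) | hf)
  · rw [Set.mem_singleton_iff] at hf
    subst hf
    simp [Derivation.leibniz_inv]
  · exact hz i
  · rw [Derivation.leibniz_inv, smul_eq_mul, map_sub]
    have := gensS_mem t (inv_mem_gensS hij)
    exact mul_mem (neg_mem (pow_mem this 2)) (sub_mem (hz i) (hz j))
  · exact ht f hf

theorem dz_z_mem (s : Subalgebra ℤ[X] (K n)) (i j : Fin n) : dz i (z j) ∈ s := by
  rw [dz_z]; split_ifs <;> simp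

theorem derivation_inv (v : Derivation ℤ[X] (K n) (K n)) (i : Fin n) :
    v (x n - z i)⁻¹ = -(x n - z i)⁻¹ ^ 2 * (v (x n) - v (z i)) := by
  rw [Derivation.leibniz_inv, smul_eq_mul, map_sub]

theorem dx_mem_OA {f : K n} (hf : f ∈ OA n) : dx n f ∈ OA n :=
  derivation_mem _ _ (by simp) (by simp) hf

theorem dz_mem_OA (i : Fin n) {f : K n} (hf : f ∈ OA n) : dz i f ∈ OA n :=
  derivation_mem _ _ (dz_z_mem _ i) (by simp) hf

theorem dz_mem_OV (i : Fin n) {f : K n} (hf : f ∈ OV n) : dz i f ∈ OV n := by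
  refine derivation_mem _ _ (dz_z_mem _ i) ?_ hf
  rintro _ ⟨j, rfl⟩
  simp only [derivation_inv, dz_x]
  exact mul_mem (neg_mem (pow_mem (inv_mem_OV j) 2)) (sub_mem (zero_mem _) (dz_z_mem _ i j))

theorem dz_mem_OU (i : Fin n) {f : K n} (hf : f ∈ OU n) : dz i f ∈ OU n := by
  refine derivation_mem _ _ (dz_z_mem _ i) ?_ hf
  rintro _ (rfl | ⟨j, rfl⟩)
  · simp
  · simp only [derivation_inv, dz_x]
    exact mul_mem (neg_mem (pow_mem (OV_le_OU (inv_mem_OV j)) 2))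
      (sub_mem (zero_mem _) (dz_z_mem _ i j))

theorem factor_mem_OA {i j : Fin n} (hij : j ≠ i) : (x n - z j) / (z i - z j) ∈ OA n := by
  rw [div_eq_mul_inv]
  exact mul_mem (sub_mem x_mem_OA (gensS_mem _ (z_mem_gensS j)))
    (gensS_mem _ (inv_mem_gensS hij.symm))

theorem lagr_mem_OA (i : Fin n) : lagr i ∈ OA n :=
  prod_mem fun _ hj => factor_mem_OA (Finset.ne_of_mem_erase hj)

theorem liftA_mem_OA (i : Fin n) {f : K n} (hf : f ∈ OA n) : liftA i f ∈ OA n := by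
  simp only [liftA, Derivation.add_apply, Derivation.smul_apply, smul_eq_mul]
  exact add_mem (dz_mem_OA i hf) (mul_mem (lagr_mem_OA i) (dx_mem_OA hf))

/-- The interpolation polynomial takes the value `1` at `z_i`. -/
theorem lagr_sub_one_div_mem (i : Fin n) (s : Finset (Fin n)) (hs : i ∉ s) :
    (∏ j ∈ s, (x n - z j) / (z i - z j)) ∈ OA n ∧
    ((∏ j ∈ s, (x n - z j) / (z i - z j)) - 1) / (x n - z i) ∈ OA n := by
  induction s using Finset.induction_on with
  | empty => simp
  | insert k s hk ih =>
    simp only [Finset.mem_insert, not_or] at hs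
    obtain ⟨h1, h2⟩ := ih hs.2
    rw [Finset.prod_insert hk]
    refine ⟨mul_mem (factor_mem_OA (Ne.symm hs.1)) h1, ?_⟩
    have e : ((x n - z k) / (z i - z k) * ∏ j ∈ s, (x n - z j) / (z i - z j)) - 1 =
        ((∏ j ∈ s, (x n - z j) / (z i - z j)) - 1) +
          (x n - z i) * ((z i - z k)⁻¹ * ∏ j ∈ s, (x n - z j) / (z i - z j)) := by
      have := z_sub_z_ne_zero hs.1
      field_simp
      ring
    rw [e, add_div, mul_div_cancel_left₀ _ (x_sub_z_ne_zero i)]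
    exact add_mem h2 (mul_mem (gensS_mem _ (inv_mem_gensS hs.1)) h1)

theorem derivation_prod_div (v : Derivation ℤ[X] (K n) (K n)) (s : Finset (Fin n)) :
    v (∏ j ∈ s, (x n - z j)) / (∏ j ∈ s, (x n - z j)) =
      ∑ j ∈ s, (v (x n) - v (z j)) / (x n - z j) := by
  induction s using Finset.induction_on with
  | empty => simp
  | insert k s hk ih =>
    rw [Finset.prod_insert hk, Finset.sum_insert hk, ← ih, Derivation.leibniz, smul_eq_mul,
      smul_eq_mul, map_sub]
    have h1 := x_sub_z_ne_zero k
    have h2 : ∏ j ∈ s, (x n - z j) ≠ 0 :=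
      Finset.prod_ne_zero_iff.2 fun i _ => x_sub_z_ne_zero i
    field_simp
    ring

theorem liftA_x (i : Fin n) : liftA i (x n) = lagr i := by simp [liftA]

theorem liftA_z (i j : Fin n) : liftA i (z j) = if j = i then 1 else 0 := by
  simp [liftA, dz_z]

/-- The vector field `∂/∂z_i + g_i ∂/∂x` is logarithmic along all divisors `x = z_j`. -/
theorem liftA_P_div_mem (i : Fin n) : liftA i (P n) / P n ∈ OA n := by
  rw [P, derivation_prod_div]
  refine sum_mem fun j _ => ?_
  rw [liftA_x, liftA_z]
  by_cases hij : j = i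
  · subst hij
    simpa [lagr] using (lagr_sub_one_div_mem j (Finset.univ.erase j) (by simp)).2
  · have hj : j ∈ Finset.univ.erase i := by simp [hij]
    rw [if_neg hij, sub_zero, lagr, ← Finset.mul_prod_erase _ _ hj]
    have h1 := x_sub_z_ne_zero j
    have e : (x n - z j) / (z i - z j) * (∏ k ∈ (Finset.univ.erase i).erase j,
          (x n - z k) / (z i - z k)) / (x n - z j) =
        (z i - z j)⁻¹ * ∏ k ∈ (Finset.univ.erase i).erase j, (x n - z k) / (z i - z k) := by
      field_simp
    rw [e]
    exact mul_mem (gensS_mem _ (inv_mem_gensS (Ne.symm hij)))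
      (lagr_sub_one_div_mem i _ (by simp)).1

theorem dz_P_div_mem (i : Fin n) : dz i (P n) / P n ∈ OV n := by
  rw [P, derivation_prod_div]
  refine sum_mem fun j _ => ?_
  rw [dz_x, div_eq_mul_inv]
  exact mul_mem (sub_mem (zero_mem _) (dz_z_mem _ i j)) (inv_mem_OV j)

theorem cov_apply (v : Derivation ℤ[X] (K n) (K n)) (f : K n) :
    cov v f = v f + h n * (v (P n) / P n) * f := rfl

theorem lieForm_apply (v : Derivation ℤ[X] (K n) (K n)) (f : K n) :
    lieForm v f = cov v f + dx n (v (x n)) * f := rfl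

theorem cov_liftA_mem_OA (i : Fin n) {f : K n} (hf : f ∈ OA n) : cov (liftA i) f ∈ OA n := by
  rw [cov_apply]
  exact add_mem (liftA_mem_OA i hf) (mul_mem (mul_mem (h_mem (OA n)) (liftA_P_div_mem i)) hf)

theorem cov_dz_mem_OV (i : Fin n) {f : K n} (hf : f ∈ OV n) : cov (dz i) f ∈ OV n := by
  rw [cov_apply]
  exact add_mem (dz_mem_OV i hf) (mul_mem (mul_mem (h_mem (OV n)) (dz_P_div_mem i)) hf)

theorem cov_dz_mem_OU (i : Fin n) {f : K n} (hf : f ∈ OU n) : cov (dz i) f ∈ OU n := by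
  rw [cov_apply]
  exact add_mem (dz_mem_OU i hf)
    (mul_mem (OV_le_OU (mul_mem (h_mem (OV n)) (dz_P_div_mem i))) hf)

theorem relNabla_apply (f : K n) : relNabla n f = dx n f + h n * (dx n (P n) / P n) * f := rfl

theorem gmCech_apply (i : Fin n) (w : K n × K n × K n) : gmCech i w =
    (lieForm (liftA i) w.1, lieForm (dz i) w.2.1, cov (dz i) w.2.2 - lagr i * w.1) := rfl

theorem cechD_apply (w : K n × K n) :
    cechD n w = (relNabla n w.1, relNabla n w.2, w.2 - w.1) := rfl

/-- The Lie derivative along `∂/∂z_i` commutes with the relative differential. -/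
theorem lieForm_dz (i : Fin n) (f : K n) :
    lieForm (dz i) (relNabla n f) = relNabla n (cov (dz i) f) := by
  have hP := P_ne_zero (n := n)
  simp only [lieForm_apply, relNabla_apply, cov_apply, dz_x, map_zero, map_add, Derivation.leibniz,
    smul_eq_mul, derivation_h, Derivation.leibniz_div, dz_dx_comm]
  field_simp
  ring

/-- The Lie derivatives along `∂/∂z_i + g_i ∂/∂x` and `∂/∂z_i` differ by `∇` of the contraction. -/
theorem lieForm_liftA (i : Fin n) (f : K n) :
    lieForm (liftA i) f = lieForm (dz i) f + relNabla n (lagr i * f) := by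
  have hP := P_ne_zero (n := n)
  simp only [lieForm_apply, relNabla_apply, cov_apply, dz_x, map_zero, map_add, Derivation.leibniz,
    smul_eq_mul, liftA, Derivation.add_apply, Derivation.smul_apply, dx_x, Derivation.map_one_eq_zero]
  field_simp
  ring

theorem mem_logFormsA {f : K n} : f ∈ logFormsA n ↔ P n * f ∈ OA n := Iff.rfl

theorem mem_logFormsV {f : K n} : f ∈ logFormsV n ↔ f ∈ OV n ∧ x n * f ∈ OV n := Iff.rfl

theorem mem_cocycles {a b c : K n} : (a, b, c) ∈ cocycles n ↔
    a ∈ logFormsA n ∧ b ∈ logFormsV n ∧ c ∈ OU n ∧ b - a = relNabla n c := Iff.rfl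

theorem lieForm_liftA_mem (i : Fin n) {a : K n} (ha : a ∈ logFormsA n) :
    lieForm (liftA i) a ∈ logFormsA n := by
  rw [mem_logFormsA] at *
  have e : P n * lieForm (liftA i) a = liftA i (P n * a) +
      (h n - 1) * (liftA i (P n) / P n) * (P n * a) + dx n (lagr i) * (P n * a) := by
    have hP := P_ne_zero (n := n)
    simp only [lieForm_apply, cov_apply, Derivation.leibniz, smul_eq_mul, liftA_x]
    field_simp
    ring
  rw [e]
  exact add_mem (add_mem (liftA_mem_OA i ha) (mul_mem (mul_mem (sub_mem (h_mem _) (one_mem _))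
    (liftA_P_div_mem i)) ha)) (mul_mem (dx_mem_OA (lagr_mem_OA i)) ha)

theorem lieForm_dz_mem (i : Fin n) {b : K n} (hb : b ∈ logFormsV n) :
    lieForm (dz i) b ∈ logFormsV n := by
  rw [mem_logFormsV] at *
  have e : lieForm (dz i) b = cov (dz i) b := by simp [lieForm_apply]
  have e' : x n * cov (dz i) b = cov (dz i) (x n * b) := by
    simp only [cov_apply, Derivation.leibniz, dz_x, smul_eq_mul]
    ring
  rw [e, e']
  exact ⟨cov_dz_mem_OV i hb.1, cov_dz_mem_OV i hb.2⟩

theorem logFormsA_le_OU {a : K n} (ha : a ∈ logFormsA n) : a ∈ OU n := by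
  rw [mem_logFormsA] at ha
  have hP : (P n)⁻¹ ∈ OU n := by
    rw [P, ← Finset.prod_inv_distrib]
    exact prod_mem fun j _ => OV_le_OU (inv_mem_OV j)
  rw [← inv_mul_cancel_left₀ P_ne_zero a]
  exact mul_mem hP (OA_le_OU ha)

theorem gmCech_mem_cocycles (i : Fin n) {w : K n × K n × K n} (hw : w ∈ cocycles n) :
    gmCech i w ∈ cocycles n := by
  obtain ⟨a, b, c⟩ := w
  rw [mem_cocycles] at hw
  obtain ⟨ha, hb, hc, habc⟩ := hw
  rw [gmCech_apply, mem_cocycles]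
  refine ⟨lieForm_liftA_mem i ha, lieForm_dz_mem i hb, sub_mem (cov_dz_mem_OU i hc)
    (mul_mem (OA_le_OU (lagr_mem_OA i)) (logFormsA_le_OU ha)), ?_⟩
  have e : b = a + relNabla n c := by rw [← habc]; ring
  rw [e, map_add, lieForm_dz, lieForm_liftA, map_sub]
  ring

theorem gmCech_cechD (i : Fin n) (w : K n × K n) :
    gmCech i (cechD n w) = cechD n (cov (liftA i) w.1, cov (dz i) w.2) := by
  obtain ⟨f, g⟩ := w
  have e : cov (liftA i) f = cov (dz i) f + lagr i * relNabla n f := by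
    have hP := P_ne_zero (n := n)
    simp only [relNabla_apply, cov_apply, liftA, Derivation.add_apply, Derivation.smul_apply,
      smul_eq_mul]
    field_simp
    ring
  simp only [gmCech_apply, cechD_apply, lieForm_liftA, lieForm_dz, e, map_add, map_sub,
    Prod.mk.injEq, true_and]
  ring

theorem gmCech_mem_coboundaries (i : Fin n) {w : K n × K n × K n} (hw : w ∈ coboundaries n) :
    gmCech i w ∈ coboundaries n := by
  obtain ⟨⟨f, g⟩, ⟨hf, hg⟩, rfl⟩ := hw
  rw [gmCech_cechD]
  refine ⟨_, ⟨?_, ?_⟩, rfl⟩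
  · exact cov_liftA_mem_OA i hf
  · exact cov_dz_mem_OV i hg

/-- The Gauss–Manin connection `∇^E` on `E` along `∂/∂z_i`. -/
def gaussManin (i : Fin n) : E n →ₗ[ℤ[X]] E n :=
  Submodule.mapQ _ _ ((gmCech i).restrict fun _ hw => gmCech_mem_cocycles i hw)
    (fun _ hw => gmCech_mem_coboundaries i hw)

/-! ### The local system `E^♭` and its de Rham cohomology -/

/-- The ring `𝔽_p[h, (h^p - h)⁻¹]`. -/
def BaseFlat (p : ℕ) : Type := Localization.Away (X ^ p - X : (ZMod p)[X])

instance (p : ℕ) : CommRing (BaseFlat p) :=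
  inferInstanceAs (CommRing (Localization.Away (X ^ p - X : (ZMod p)[X])))

instance (p : ℕ) : Algebra (ZMod p)[X] (BaseFlat p) :=
  inferInstanceAs (Algebra (ZMod p)[X] (Localization.Away (X ^ p - X : (ZMod p)[X])))

/-- The structure of a `ℤ[h]`-algebra with `h ↦ h`. -/
instance (p : ℕ) : Algebra ℤ[X] (BaseFlat p) :=
  ((algebraMap (ZMod p)[X] (BaseFlat p)).comp (mapRingHom (Int.castRingHom (ZMod p)))).toAlgebra

variable (n) in
/-- `E^♭ = E ⊗_{ℤ[h]} 𝔽_p[h, (h^p - h)⁻¹]`. -/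
def EFlat (p : ℕ) : Type := TensorProduct ℤ[X] (E n) (BaseFlat p)

instance (p : ℕ) : AddCommGroup (EFlat n p) :=
  inferInstanceAs (AddCommGroup (TensorProduct ℤ[X] (E n) (BaseFlat p)))

instance (p : ℕ) : Module ℤ[X] (EFlat n p) :=
  inferInstanceAs (Module ℤ[X] (TensorProduct ℤ[X] (E n) (BaseFlat p)))

/-- The connection on `E^♭` along `∂/∂z_i` induced by the Gauss–Manin connection on `E`. -/
def nablaFlat (p : ℕ) (i : Fin n) : EFlat n p →ₗ[ℤ[X]] EFlat n p :=
  (gaussManin i).rTensor (BaseFlat p)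

variable (n) in
/-- `m`-forms on `S` with values in `E^♭`.  As `Ω^m_S` is free with basis
`dz_{I_1} ∧ ⋯ ∧ dz_{I_m}`, `I_1 < ⋯ < I_m`, the form `∑_I ω_I dz_I` is represented by the family of
its coefficients `ω_I`. -/
abbrev Forms (p m : ℕ) : Type := (Fin m ↪o Fin n) → EFlat n p

variable (n) in
/-- The differential `∑_I ω_I dz_I ↦ ∑_I ∑_i (∇_{∂/∂z_i} ω_I) dz_i ∧ dz_I` of the de Rham complex of
`E^♭`. -/
def deRhamD (p m : ℕ) : Forms n p m →ₗ[ℤ[X]] Forms n p (m + 1) :=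
  LinearMap.pi fun I => ∑ k : Fin (m + 1), (-1 : ℤ) ^ (k : ℕ) •
    (nablaFlat p (I k)).comp (LinearMap.proj ((Fin.succAboveOrderEmb k).trans I))

variable (n) in
/-- The exact `m`-forms with values in `E^♭`. -/
def exactForms (p : ℕ) : (m : ℕ) → Submodule ℤ[X] (Forms n p m)
  | 0 => ⊥
  | m + 1 => LinearMap.range (deRhamD n p m)

variable (n) in
/-- The de Rham cohomology `H^m_{dR}(S, E^♭)`, that is (`S` being affine) the cohomology of the
complex of global forms on `S` with values in `E^♭`. -/
abbrev DeRhamCohomology (p m : ℕ) : Type :=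
  LinearMap.ker (deRhamD n p m) ⧸ (exactForms n p m).submoduleOf (LinearMap.ker (deRhamD n p m))

end LogLocalSystem

end

open Polynomial

noncomputable section

/-! ### Rings in which a prime vanishes -/

section PrimeChar

variable {R : Type*} [Ring R] {p : ℕ}

/-! Everything rests on the scaling action. The Euler field e = ∑ z_i ∂/∂z_i on S lifts to ∑ z_i
∂/∂z_i + x ∂/∂x, which is logarithmic on all of ℙ¹_S, and P is homogeneous of degree n. Hence ∇_e on
E is nh plus the operator θ induced by the ordinary Lie derivative along the lift (`eulerE_toE`).
The rings in the Čech complex are spanned over ℤ[h] by homogeneous monomials, on which θ has integer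
eigenvalues, so by Fermat θ^p - θ is divisible by p on E (`eulerE_pow_prime`).

On E^♭ one has p = 0, and nh commutes with θ, so ∇_e^p - ∇_e = (nh)^p - nh = n(h^p - h)
(`eulerFlat_pow_prime_sub`). This is invertible when p does not divide n. As T + k is a factor of
T^p - T modulo p, every ∇_e + k is invertible (`bijective_eulerFlat_add`).

In degree 0, flat sections are killed by ∇_e, hence vanish. In positive degree, Cartan's formula
says that dι_e + ι_e d acts on the coefficients of an m-form by ∇_e + m. It commutes with d, so a
closed m-form ω is d of (∇_e + m - 1)⁻¹ ι_e ω (`exists_primitive`). This needs flatness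
(`gaussManin_comm`) and the Weyl algebra relation (`gaussManin_mulZ`). -/

theorem prime_dvd_intCast_pow_sub (p : ℕ) [Fact p.Prime] (k : ℤ) : (p : ℤ) ∣ k ^ p - k := by
  rw [← ZMod.intCast_eq_intCast_iff_dvd_sub]
  push_cast
  rw [ZMod.pow_card]

theorem intCast_eq_zero_of_dvd (hp : (p : R) = 0) {k : ℤ} (hk : (p : ℤ) ∣ k) : (k : R) = 0 := by
  obtain ⟨c, rfl⟩ := hk
  simp [hp]

variable [Fact p.Prime]

theorem intCast_pow_prime (hp : (p : R) = 0) (k : ℤ) : (k : R) ^ p = k := by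
  have := intCast_eq_zero_of_dvd hp (prime_dvd_intCast_pow_sub p k)
  push_cast at this
  exact sub_eq_zero.1 this

theorem Commute.add_pow_prime_of_natCast_eq_zero (hp : (p : R) = 0) {a b : R} (hab : Commute a b) :
    (a + b) ^ p = a ^ p + b ^ p := by
  rw [hab.add_pow_prime_eq Fact.out, hp]
  simp

theorem isUnit_natCast_of_not_dvd (hp : (p : R) = 0) {k : ℕ} (hk : ¬ p ∣ k) : IsUnit (k : R) := by
  have hc : IsCoprime (p : ℤ) (k : ℤ) :=
    Nat.isCoprime_iff_coprime.2 ((Nat.Prime.coprime_iff_not_dvd Fact.out).2 hk)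
  obtain ⟨a, b, hab⟩ := hc
  have h1 := congrArg (Int.cast : ℤ → R) hab
  push_cast at h1
  rw [hp, mul_zero, zero_add] at h1
  exact ⟨⟨k, b, by rw [← h1, Nat.cast_comm], h1⟩, rfl⟩

/-- If `x ^ p - x` is a unit in a ring of characteristic `p`, all the `x + k` are units. -/
theorem isUnit_add_natCast (hp : (p : R) = 0) {a : R} (ha : IsUnit (a ^ p - a)) (k : ℕ) :
    IsUnit (a + k) := by
  have h1 : (a + k) ^ p - (a + k) = a ^ p - a := by
    rw [(Nat.commute_cast a k).add_pow_prime_of_natCast_eq_zero hp]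
    have := intCast_pow_prime hp (k : ℤ)
    push_cast at this
    rw [this]
    abel
  -- The ring is not commutative, so being a factor of a unit is not enough; the two factors also
  -- commute.
  have h2 : (a + k) ^ p - (a + k) = (a + k) * ((a + k) ^ (p - 1) - 1) := by
    rw [mul_sub, mul_one, ← pow_succ', Nat.sub_add_cancel (Nat.Prime.one_le Fact.out)]
  have hc : Commute (a + k) ((a + k) ^ (p - 1) - 1) :=
    ((Commute.refl _).pow_right _).sub_right (Commute.one_right _)
  rw [← h1, h2, hc.isUnit_mul_iff] at ha
  exact ha.1

end PrimeChar

/-! ### The de Rham complex of a module over the Weyl algebra -/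

section DeRham

variable {n m : ℕ} {A : Type*} [AddCommGroup A]

/-- Both ranges have m elements, and an increasing family is determined by its range. -/
theorem OrderEmbedding.eq_of_range_subset (I J : Fin m ↪o Fin n)
    (hIJ : ∀ j, J j ∈ Set.range I) : J = I := by
  have h1 : Finset.univ.image J = Finset.univ.image I := by
    apply Finset.eq_of_subset_of_card_le
    · intro a ha
      simp only [Finset.mem_image, Finset.mem_univ, true_and] at ha ⊢
      obtain ⟨j, rfl⟩ := ha
      exact hIJ j
    · rw [Finset.card_image_of_injective _ I.injective,
        Finset.card_image_of_injective _ J.injective]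
  have h2 : Set.range J = Set.range I := by
    have := congrArg (fun s : Finset (Fin n) => (s : Set (Fin n))) h1
    simpa using this
  exact OrderEmbedding.range_inj.1 h2

/-- If I ≠ J, some J j lies outside the range of I and gives a zero row. This is the duality between
the dz_I and the families of basis vectors. -/
theorem det_orderEmbedding (I J : Fin m ↪o Fin n) :
    Matrix.det (Matrix.of fun j k : Fin m => (Pi.single (J j) 1 : Fin n → ℤ) (I k)) =
      if I = J then 1 else 0 := by
  split_ifs with h
  · subst h
    convert Matrix.det_one (n := Fin m) (R := ℤ) using 2
    ext j k
    simp [Matrix.one_apply, Pi.single_apply, eq_comm]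
  · by_cases hIJ : ∀ j, J j ∈ Set.range I
    · exact absurd (OrderEmbedding.eq_of_range_subset I J hIJ).symm h
    · push Not at hIJ
      obtain ⟨j, hj⟩ := hIJ
      refine Matrix.det_eq_zero_of_row_eq_zero j fun k => ?_
      simp only [Matrix.of_apply, Pi.single_apply, ite_eq_right_iff]
      intro hk
      exact absurd ⟨k, hk⟩ hj

theorem AlternatingMap.sum_apply' {R M N ι κ : Type*} [CommRing R] [AddCommGroup M] [AddCommGroup N]
    [Module R M] [Module R N] (s : Finset κ) (f : κ → M [⋀^ι]→ₗ[R] N) (v : ι → M) :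
    (∑ i ∈ s, f i) v = ∑ i ∈ s, f i v :=
  map_sum (⟨⟨fun g => g v, rfl⟩, fun _ _ => rfl⟩ : (M [⋀^ι]→ₗ[R] N) →+ N) f s

/-- The alternating map on `ℤ^n` with prescribed values on increasing families of basis vectors. -/
def alternatingOfForm (ω : (Fin m ↪o Fin n) → A) : (Fin n → ℤ) [⋀^Fin m]→ₗ[ℤ] A :=
  ∑ I : Fin m ↪o Fin n, (LinearMap.toSpanSingleton ℤ A (ω I)).compAlternatingMap
    ((Matrix.detRowAlternating (n := Fin m) (R := ℤ)).compLinearMap (LinearMap.funLeft ℤ ℤ I))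

theorem alternatingOfForm_apply (ω : (Fin m ↪o Fin n) → A) (J : Fin m ↪o Fin n) :
    alternatingOfForm ω (fun j => Pi.single (J j) 1) = ω J := by
  have h : ∀ I : Fin m ↪o Fin n, (Matrix.detRowAlternating (n := Fin m) (R := ℤ))
      (fun j => LinearMap.funLeft ℤ ℤ I (Pi.single (J j) 1)) = if I = J then 1 else 0 :=
    fun I => det_orderEmbedding I J
  rw [alternatingOfForm, AlternatingMap.sum_apply']
  simp only [LinearMap.compAlternatingMap_apply, AlternatingMap.compLinearMap_apply,
    LinearMap.toSpanSingleton_apply]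
  rw [Finset.sum_eq_single J]
  · erw [h]; simp
  · intro I _ hI
    erw [h]; simp [hI]
  · simp

/-- An alternating map on `ℤ^n` vanishes if it does so on increasing families of basis vectors. -/
theorem AlternatingMap.eq_zero_of_orderEmbedding (α : (Fin n → ℤ) [⋀^Fin m]→ₗ[ℤ] A)
    (hα : ∀ J : Fin m ↪o Fin n, α (fun j => Pi.single (J j) 1) = 0) : α = 0 := by
  refine Module.Basis.ext_alternating (Pi.basisFun ℤ (Fin n)) fun v hv => ?_
  -- Sorting an injective family makes it increasing and changes the value of α only by a sign.
  have hs : StrictMono (v ∘ Tuple.sort v) :=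
    (Tuple.monotone_sort v).strictMono_of_injective (hv.comp (Tuple.sort v).injective)
  have h1 := hα (OrderEmbedding.ofStrictMono _ hs)
  have h2 := α.map_perm (fun i => (Pi.single (v i) 1 : Fin n → ℤ)) (Tuple.sort v)
  have h3 : (fun j => (Pi.single ((OrderEmbedding.ofStrictMono _ hs) j) 1 : Fin n → ℤ)) =
    (fun i => (Pi.single (v i) 1 : Fin n → ℤ)) ∘ (Tuple.sort v) := rfl
  rw [h3, h2] at h1
  have h4 := (smul_eq_zero_iff_eq (Equiv.Perm.sign (Tuple.sort v))).1 h1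
  simpa using h4

variable (D Z : Fin n → A →+ A)

/-- The exterior derivative of a form with values in `A`. -/
def extD (α : (Fin n → ℤ) [⋀^Fin m]→ₗ[ℤ] A) : (Fin n → ℤ) [⋀^Fin (m + 1)]→ₗ[ℤ] A :=
  AlternatingMap.alternatizeUncurryFin
    (∑ i, (LinearMap.proj i).smulRight ((D i).toIntLinearMap.compAlternatingMap α))

/-- This is the coordinate formula of `deRhamD`, but for families v that need not be increasing:
contraction with the Euler field puts an arbitrary index in front. -/
theorem extD_apply (α : (Fin n → ℤ) [⋀^Fin m]→ₗ[ℤ] A) (v : Fin (m + 1) → Fin n) :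
    extD D α (fun j => Pi.single (v j) 1) =
      ∑ k : Fin (m + 1), (-1 : ℤ) ^ (k : ℕ) •
        D (v k) (α fun j => Pi.single (v (k.succAbove j)) 1) := by
  rw [extD, AlternatingMap.alternatizeUncurryFin_apply]
  refine Finset.sum_congr rfl fun k _ => ?_
  congr 1
  rw [LinearMap.sum_apply, AlternatingMap.sum_apply', Finset.sum_eq_single (v k)]
  · simp
    rfl
  · intro i _ hi
    simp [hi]
  · simp

/-- **Poincaré lemma**: if the operators `∑ Z_i D_i + k`, `k ≥ 0`, are bijective, then closed forms
of positive degree are exact. -/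
theorem exists_primitive (hDZ : ∀ i j a, D i (Z j a) = Z j (D i a) + if i = j then a else 0)
    (hDD : ∀ i j a, D i (D j a) = D j (D i a))
    (hbij : ∀ k : ℕ, Function.Bijective fun a => ∑ i, Z i (D i a) + k • a)
    (ω : (Fin (m + 1) ↪o Fin n) → A)
    (hω : ∀ I : Fin (m + 2) ↪o Fin n, ∑ k : Fin (m + 2), (-1 : ℤ) ^ (k : ℕ) •
      D (I k) (ω ((Fin.succAboveOrderEmb k).trans I)) = 0) :
    ∃ η : (Fin m ↪o Fin n) → A, ∀ I : Fin (m + 1) ↪o Fin n, ∑ k : Fin (m + 1),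
      (-1 : ℤ) ^ (k : ℕ) • D (I k) (η ((Fin.succAboveOrderEmb k).trans I)) = ω I := by
  set α := alternatingOfForm ω with hα
  have hclosed : extD D α = 0 := by
    refine AlternatingMap.eq_zero_of_orderEmbedding _ fun J => ?_
    rw [extD_apply, ← hω J]
    refine Finset.sum_congr rfl fun k _ => ?_
    rw [← alternatingOfForm_apply ω ((Fin.succAboveOrderEmb k).trans J)]
    rfl
  let b : (l : ℕ) → (Fin l → Fin n) → (Fin l → Fin n → ℤ) := fun l v j => Pi.single (v j) 1
  -- The contraction ι_e ω. The primitive η is its preimage under ∑ Z_i D_i + m, the Lie derivative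
  -- on m-forms.
  let τ : (Fin m ↪o Fin n) → A := fun J => ∑ i, Z i (α (b _ (Fin.cons i J : Fin (m + 1) → Fin n)))
  choose η hη using fun J => (hbij m).2 (τ J)
  -- It suffices to compare dη and ω after applying the Lie derivative on (m + 1)-forms, which is
  -- injective.
  refine ⟨η, fun I => (hbij (m + 1)).1 ?_⟩
  -- The Lie derivative commutes with d; the shift from m to m + 1 absorbs the commutator of D_i
  -- with ∑ Z_j D_j.
  have hDL : ∀ i a, ∑ j, Z j (D j (D i a)) + (m + 1) • D i a =
      D i (∑ j, Z j (D j a) + m • a) := by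
    intro i a
    simp only [map_add, map_sum, hDZ, map_nsmul, Finset.sum_add_distrib, hDD i]
    simp only [Finset.sum_ite_eq, Finset.mem_univ, if_true, add_smul, one_smul]
    abel
  -- Closedness of ω, evaluated at the basis vectors with indices (i, I).
  have hι : ∀ i, ∑ k : Fin (m + 1), (-1 : ℤ) ^ (k : ℕ) •
      D (I k) (α (b _ (Fin.cons i (I ∘ k.succAbove) : Fin (m + 1) → Fin n))) = D i (ω I) := by
    intro i
    have h1 := DFunLike.congr_fun hclosed (b _ (Fin.cons i I : Fin (m + 2) → Fin n))
    rw [extD_apply, Fin.sum_univ_succ] at h1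
    simp only [Fin.val_zero, pow_zero, one_smul, Fin.cons_zero, Fin.succAbove_zero, Fin.cons_succ,
      Fin.val_succ, AlternatingMap.zero_apply, pow_succ, mul_neg_one, neg_smul,
      Finset.sum_neg_distrib] at h1
    rw [hα, alternatingOfForm_apply, ← sub_eq_add_neg, sub_eq_zero] at h1
    rw [h1]
    refine Finset.sum_congr rfl fun k _ => ?_
    congr 3
    funext j
    refine Fin.cases ?_ (fun j => ?_) j
    · simp [b]
    · simp [b, Fin.succ_succAbove_succ]
  -- Moving I k from the front back to position k costs the sign (-1)^k.
  have hperm : ∀ k : Fin (m + 1), (-1 : ℤ) ^ (k : ℕ) •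
      α (b _ (Fin.cons (I k) (I ∘ k.succAbove) : Fin (m + 1) → Fin n)) = ω I := by
    intro k
    have h1 := α.map_insertNth k (Pi.single (I k) 1) (b _ (I ∘ k.succAbove))
    have h2 : k.insertNth (α := fun _ => Fin n → ℤ) (Pi.single (I k) 1) (b _ (I ∘ k.succAbove)) =
        fun j => Pi.single (I j) 1 := by
      rw [Fin.insertNth_eq_iff]
      exact ⟨rfl, rfl⟩
    have h3 : b _ (Fin.cons (I k) (I ∘ k.succAbove) : Fin (m + 1) → Fin n) =
        Matrix.vecCons (Pi.single (I k) 1 : Fin n → ℤ) (b _ (I ∘ k.succAbove)) := by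
      funext j
      refine Fin.cases ?_ (fun j => ?_) j <;> simp [b]
    rw [h3, ← h1, h2, hα, alternatingOfForm_apply]
  -- Moving D past Z leaves one extra ω I for each k; these m + 1 copies are the degree term of the
  -- Lie derivative.
  have hτ : ∀ k : Fin (m + 1), (-1 : ℤ) ^ (k : ℕ) •
      D (I k) (τ ((Fin.succAboveOrderEmb k).trans I)) =
      ∑ i, Z i ((-1 : ℤ) ^ (k : ℕ) •
        D (I k) (α (b _ (Fin.cons i (I ∘ k.succAbove) : Fin (m + 1) → Fin n)))) + ω I := by
    intro k
    rw [← hperm k]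
    simp only [τ, map_sum, hDZ, Finset.sum_add_distrib, Finset.sum_ite_eq, Finset.mem_univ, if_true,
      smul_add, Finset.smul_sum, map_zsmul]
    rfl
  calc _ = ∑ k : Fin (m + 1), (-1 : ℤ) ^ (k : ℕ) •
        D (I k) (τ ((Fin.succAboveOrderEmb k).trans I)) := by
        simp only [← hη, ← hDL, map_sum, map_zsmul, Finset.smul_sum, smul_add]
        rw [Finset.sum_comm, ← Finset.sum_add_distrib]
        simp only [smul_comm (m + 1)]
    _ = _ := by
        simp only [hτ, Finset.sum_add_distrib]
        rw [Finset.sum_comm]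
        simp only [← map_sum, hι]
        simp

end DeRham

namespace LogLocalSystem

variable {n : ℕ}

/-! ### Flatness of the Gauss–Manin connection -/

theorem dz_dz_comm (i j : Fin n) (f : K n) : dz i (dz j f) = dz j (dz i f) := by
  have h0 := derivation_fractionRing_eq_zero (R := ℤ[X])
    (A := MvPolynomial (Option (Fin n)) ℤ[X]) ⁅dz i, dz j⁆ (fun a => by
    rw [Derivation.commutator_apply]
    simp only [dz, fracDerivation_algebraMap]
    rw [← map_sub, ← Derivation.commutator_apply]
    have e : ∀ D D' : Derivation ℤ[X] (MvPolynomial (Option (Fin n)) ℤ[X])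
        (MvPolynomial (Option (Fin n)) ℤ[X]), (∀ j, ⁅D, D'⁆ (.X j) = 0) → ⁅D, D'⁆ = 0 :=
      fun D D' hD => MvPolynomial.derivation_ext hD
    rw [e _ _ fun j => ?_]
    · simp
    · rw [Derivation.commutator_apply]
      simp only [MvPolynomial.pderiv_X, Pi.single_apply]
      split_ifs <;> simp) f
  rw [Derivation.commutator_apply] at h0
  exact sub_eq_zero.1 h0

/-- The form dP/P is closed, so twisting by it creates no curvature. -/
theorem cov_dz_comm (i j : Fin n) (f : K n) :
    cov (dz i) (cov (dz j) f) = cov (dz j) (cov (dz i) f) := by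
  have hP := P_ne_zero (n := n)
  simp only [cov_apply, map_add, Derivation.leibniz, smul_eq_mul, derivation_h,
    Derivation.leibniz_div, dz_dz_comm j i]
  field_simp
  ring

theorem lieForm_dz_eq_cov (i : Fin n) (f : K n) : lieForm (dz i) f = cov (dz i) f := by
  simp [lieForm_apply]

theorem cov_mul (v : Derivation ℤ[X] (K n) (K n)) (f g : K n) :
    cov v (f * g) = v f * g + f * cov v g := by
  simp only [cov_apply, Derivation.leibniz, smul_eq_mul]
  ring

theorem relNabla_mul (f g : K n) : relNabla n (f * g) = dx n f * g + f * relNabla n g :=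
  cov_mul _ _ _

/-- On V the lifts commute. On 𝔸¹_S their bracket is a vertical field, and the Lie derivative along
a vertical field is ∇ of the contraction by Cartan's formula; so the commutator is a Čech
differential. -/
theorem gmCech_gmCech_sub (i j : Fin n) (a b c : K n) :
    gmCech i (gmCech j (a, b, c)) - gmCech j (gmCech i (a, b, c)) =
      cechD n ((liftA i (lagr j) - liftA j (lagr i)) * a, 0) := by
  simp only [gmCech_apply, cechD_apply, lieForm_liftA, lieForm_dz_eq_cov, map_add, map_sub,
    map_zero, Prod.mk_sub_mk, Prod.mk.injEq, cov_dz_comm j i, sub_self, true_and]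
  have h1 : ∀ i (f : K n), cov (dz i) (relNabla n f) = relNabla n (cov (dz i) f) := by
    intro i f
    rw [← lieForm_dz, lieForm_dz_eq_cov]
  simp only [h1, cov_mul, liftA, Derivation.add_apply, Derivation.smul_apply, smul_eq_mul]
  constructor
  · simp only [map_add, map_sub, relNabla_mul, Derivation.leibniz, smul_eq_mul, add_mul, sub_mul]
    ring
  · simp only [relNabla_mul]
    ring

/-- The numerator is the value of `liftA i` on x - z_j, so this is tangency to the section x = z_j.
-/
theorem lagr_sub_div_mem (i j : Fin n) :
    (lagr i - if j = i then 1 else 0) / (x n - z j) ∈ OA n := by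
  by_cases hij : j = i
  · subst hij
    simpa [lagr] using (lagr_sub_one_div_mem j (Finset.univ.erase j) (by simp)).2
  · have hj : j ∈ Finset.univ.erase i := by simp [hij]
    rw [if_neg hij, sub_zero, lagr, ← Finset.mul_prod_erase _ _ hj]
    have h1 := x_sub_z_ne_zero j
    have e : (x n - z j) / (z i - z j) * (∏ k ∈ (Finset.univ.erase i).erase j,
          (x n - z k) / (z i - z k)) / (x n - z j) =
        (z i - z j)⁻¹ * ∏ k ∈ (Finset.univ.erase i).erase j, (x n - z k) / (z i - z k) := by
      field_simp
    rw [e]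
    exact mul_mem (gensS_mem _ (inv_mem_gensS (Ne.symm hij)))
      (lagr_sub_one_div_mem i _ (by simp)).1

/-- A field tangent to a section preserves the ideal of that section. -/
theorem liftA_div_mem (i k : Fin n) {f : K n} (hf : f / (x n - z k) ∈ OA n) :
    liftA i f / (x n - z k) ∈ OA n := by
  have hk := x_sub_z_ne_zero k
  have e : liftA i f / (x n - z k) = (lagr i - if k = i then 1 else 0) / (x n - z k) *
      (f / (x n - z k)) + liftA i (f / (x n - z k)) := by
    rw [Derivation.leibniz_div, map_sub, liftA_x, liftA_z]
    simp only [smul_eq_mul]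
    field_simp
    ring
  rw [e]
  exact add_mem (mul_mem (lagr_sub_div_mem i k) hf) (liftA_mem_OA i hf)

theorem liftA_lagr_div_mem (i j k : Fin n) : liftA i (lagr j) / (x n - z k) ∈ OA n := by
  have h1 := liftA_div_mem i k (lagr_sub_div_mem j k)
  have h2 : liftA i (if k = j then (1 : K n) else 0) = 0 := by split_ifs <;> simp
  rwa [map_sub, h2, sub_zero] at h1

/-- A function on `𝔸¹_S` that is divisible by all `x - z_k`, `k ∈ s`, is divisible by their
product. -/
theorem div_prod_mem (s : Finset (Fin n)) {f : K n} (hf0 : f ∈ OA n)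
    (hf : ∀ k ∈ s, f / (x n - z k) ∈ OA n) : f / ∏ k ∈ s, (x n - z k) ∈ OA n := by
  induction s using Finset.induction_on generalizing f with
  | empty => simpa
  | insert k s hk ih =>
    rw [Finset.prod_insert hk, ← div_div]
    refine ih (hf k (by simp)) fun l hl => ?_
    have hlk : l ≠ k := by rintro rfl; exact hk hl
    have h1 := x_sub_z_ne_zero k
    have h2 := x_sub_z_ne_zero l
    have h3 := z_sub_z_ne_zero hlk
    -- Partial fractions, possible because z_l - z_k is invertible on S.
    have e : f / (x n - z k) / (x n - z l) =
        (f / (x n - z l) - f / (x n - z k)) * (z l - z k)⁻¹ := by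
      field_simp
      ring
    rw [e]
    exact mul_mem (sub_mem (hf l (by simp [hl])) (hf k (by simp)))
      (gensS_mem _ (inv_mem_gensS hlk))

/-- The coefficient of the bracket of two lifts vanishes on every section x = z_k, so it is
divisible by P and cancels the logarithmic poles of a. The primitive is therefore regular on 𝔸¹_S.
-/
theorem gmCech_comm_mem (i j : Fin n) {w : K n × K n × K n} (hw : w ∈ cocycles n) :
    gmCech i (gmCech j w) - gmCech j (gmCech i w) ∈ coboundaries n := by
  obtain ⟨a, b, c⟩ := w
  rw [gmCech_gmCech_sub]
  refine ⟨_, ⟨?_, zero_mem _⟩, rfl⟩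
  have h1 : (liftA i (lagr j) - liftA j (lagr i)) / P n ∈ OA n := by
    refine div_prod_mem _ (sub_mem (liftA_mem_OA i (lagr_mem_OA j))
      (liftA_mem_OA j (lagr_mem_OA i))) fun k _ => ?_
    rw [sub_div]
    exact sub_mem (liftA_lagr_div_mem i j k) (liftA_lagr_div_mem j i k)
  have h2 := mul_mem h1 (mem_logFormsA.1 hw.1)
  have hP := P_ne_zero (n := n)
  rw [← mul_assoc, div_mul_cancel₀ _ hP] at h2
  exact h2

variable (n) in
/-- The class of a cocycle. -/
def toE : cocycles n →ₗ[ℤ[X]] E n := Submodule.mkQ _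

theorem toE_surjective : Function.Surjective (toE n) := Submodule.mkQ_surjective _

theorem toE_eq_iff (v w : cocycles n) :
    toE n v = toE n w ↔ (v : K n × K n × K n) - w ∈ coboundaries n := by
  rw [toE, Submodule.mkQ_apply, Submodule.mkQ_apply, Submodule.Quotient.eq]
  rfl

theorem gaussManin_toE (i : Fin n) (w : cocycles n) :
    gaussManin i (toE n w) = toE n ⟨gmCech i w, gmCech_mem_cocycles i w.2⟩ := rfl

/-- The Gauss–Manin connection is flat. -/
theorem gaussManin_comm (i j : Fin n) (e : E n) :
    gaussManin i (gaussManin j e) = gaussManin j (gaussManin i e) := by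
  obtain ⟨w, rfl⟩ := toE_surjective e
  rw [gaussManin_toE, gaussManin_toE, gaussManin_toE, gaussManin_toE, toE_eq_iff]
  exact gmCech_comm_mem i j w.2

/-! ### Multiplication by the coordinates of `S` -/

theorem z_mem_OA (i : Fin n) : z i ∈ OA n := gensS_mem _ (z_mem_gensS i)

theorem z_mem_OV (i : Fin n) : z i ∈ OV n := gensS_mem _ (z_mem_gensS i)

theorem relNabla_z_mul (i : Fin n) (f : K n) : relNabla n (z i * f) = z i * relNabla n f := by
  rw [relNabla_mul, dx_z, zero_mul, zero_add]

/-- Multiplication by `z_i` on triples. -/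
def cechZ (i : Fin n) : K n × K n × K n →ₗ[ℤ[X]] K n × K n × K n :=
  (LinearMap.mulLeft ℤ[X] (z i)).prodMap
    ((LinearMap.mulLeft ℤ[X] (z i)).prodMap (LinearMap.mulLeft ℤ[X] (z i)))

theorem cechZ_apply (i : Fin n) (w : K n × K n × K n) :
    cechZ i w = (z i * w.1, z i * w.2.1, z i * w.2.2) := rfl

theorem cechZ_mem_cocycles (i : Fin n) {w : K n × K n × K n} (hw : w ∈ cocycles n) :
    cechZ i w ∈ cocycles n := by
  obtain ⟨a, b, c⟩ := w
  rw [mem_cocycles] at hw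
  obtain ⟨ha, hb, hc, habc⟩ := hw
  rw [cechZ_apply, mem_cocycles]
  refine ⟨?_, ?_, mul_mem (OA_le_OU (z_mem_OA i)) hc, ?_⟩
  · rw [mem_logFormsA] at *
    rw [mul_left_comm]
    exact mul_mem (z_mem_OA i) ha
  · rw [mem_logFormsV] at *
    rw [mul_left_comm]
    exact ⟨mul_mem (z_mem_OV i) hb.1, mul_mem (z_mem_OV i) hb.2⟩
  · rw [relNabla_z_mul, ← habc]
    ring

theorem cechZ_mem_coboundaries (i : Fin n) {w : K n × K n × K n} (hw : w ∈ coboundaries n) :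
    cechZ i w ∈ coboundaries n := by
  obtain ⟨⟨f, g⟩, ⟨hf, hg⟩, rfl⟩ := hw
  refine ⟨(z i * f, z i * g), ⟨(OA n).mul_mem (z_mem_OA i) hf, (OV n).mul_mem (z_mem_OV i) hg⟩, ?_⟩
  simp only [cechD_apply, cechZ_apply, relNabla_z_mul, mul_sub]

/-- Multiplication by `z_i` on `E`. -/
def mulZ (i : Fin n) : E n →ₗ[ℤ[X]] E n :=
  Submodule.mapQ _ _ ((cechZ i).restrict fun _ hw => cechZ_mem_cocycles i hw)
    (fun _ hw => cechZ_mem_coboundaries i hw)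

theorem mulZ_toE (i : Fin n) (w : cocycles n) :
    mulZ i (toE n w) = toE n ⟨cechZ i w, cechZ_mem_cocycles i w.2⟩ := rfl

/-- Leibniz rule: both lifts of ∂/∂z_i send z_j to δ_ij, so the relation already holds on triples.
-/
theorem gmCech_cechZ (i j : Fin n) (w : K n × K n × K n) :
    gmCech i (cechZ j w) = cechZ j (gmCech i w) + if i = j then w else 0 := by
  obtain ⟨a, b, c⟩ := w
  have h1 : ∀ (v : Derivation ℤ[X] (K n) (K n)) f, lieForm v (z j * f) =
      v (z j) * f + z j * lieForm v f := by
    intro v f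
    rw [lieForm_apply, lieForm_apply, cov_mul]
    ring
  simp only [gmCech_apply, cechZ_apply, h1, cov_mul, dz_z, liftA_z, eq_comm (a := j)]
  split_ifs <;> simp only [Prod.mk_add_mk, Prod.mk.injEq, add_zero] <;>
    refine ⟨?_, ?_, ?_⟩ <;> ring

theorem gaussManin_mulZ (i j : Fin n) (e : E n) :
    gaussManin i (mulZ j e) = mulZ j (gaussManin i e) + if i = j then e else 0 := by
  obtain ⟨w, rfl⟩ := toE_surjective e
  have e1 : (if i = j then toE n w else 0) = toE n (if i = j then w else 0) := by
    split_ifs <;> simp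
  rw [mulZ_toE, gaussManin_toE, gaussManin_toE, mulZ_toE, e1, ← map_add]
  congr 1
  apply Subtype.ext
  have := gmCech_cechZ i j (w : K n × K n × K n)
  simp only [this, Submodule.coe_add]
  split_ifs <;> simp

/-! ### The Euler field -/

variable (n) in
/-- The Euler field `∑ z_i ∂/∂z_i + x ∂/∂x`. -/
def euler : Derivation ℤ[X] (K n) (K n) := ∑ i, z i • dz i + x n • dx n

theorem euler_apply (f : K n) : euler n f = ∑ i, z i * dz i f + x n * dx n f := by
  simp only [euler, Derivation.add_apply, Derivation.smul_apply, smul_eq_mul]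
  rw [← Derivation.coeFnAddMonoidHom_apply, map_sum, Finset.sum_apply]
  rfl

@[simp] theorem euler_x : euler n (x n) = x n := by simp [euler_apply]

@[simp] theorem euler_z (i : Fin n) : euler n (z i) = z i := by simp [euler_apply, dz_z]

theorem euler_P : euler n (P n) = n * P n := by
  have h1 := derivation_prod_div (euler n) Finset.univ
  rw [← P, div_eq_iff (P_ne_zero (n := n))] at h1
  rw [h1]
  simp [div_self (x_sub_z_ne_zero _)]

theorem euler_dx (f : K n) : euler n (dx n f) = dx n (euler n f) - dx n f := by
  simp only [euler_apply, map_add, map_sum, Derivation.leibniz, smul_eq_mul, dx_z, dx_x, dz_dx_comm]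
  simp only [mul_zero, add_zero, mul_one]
  ring

/-- The operator `f ↦ e f + k f` with `e` the Euler field. -/
def eulerShift (k : ℤ) : Module.End ℤ[X] (K n) :=
  (euler n : K n →ₗ[ℤ[X]] K n) + (k : Module.End ℤ[X] (K n))

theorem eulerShift_apply (k : ℤ) (f : K n) : eulerShift k f = euler n f + k * f := by
  rw [eulerShift, LinearMap.add_apply, Module.End.intCast_apply, zsmul_eq_mul]
  rfl

/-- The form dP/P is invariant under scaling and dx has weight 1: hence shift 0 on functions and
shift 1 on coefficients of dx. -/
theorem relNabla_eulerShift (f : K n) :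
    relNabla n (eulerShift 0 f) = eulerShift 1 (relNabla n f) := by
  have hP := P_ne_zero (n := n)
  simp only [relNabla_apply, eulerShift_apply, map_add, Derivation.leibniz, Derivation.leibniz_div,
    smul_eq_mul, euler_dx, euler_P, derivation_h, Derivation.map_natCast, Int.cast_zero, map_zero]
  field_simp
  push_cast
  ring

theorem relNabla_eulerShift_pow (j : ℕ) (f : K n) :
    relNabla n ((eulerShift 0 ^ j) f) = (eulerShift 1 ^ j) (relNabla n f) := by
  induction j with
  | zero => simp
  | succ j ih => rw [pow_succ', pow_succ', Module.End.mul_apply, Module.End.mul_apply,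
      relNabla_eulerShift, ih]

theorem mul_eulerShift_pow {g : K n} {d : ℤ} (hg : euler n g = d * g) (k : ℤ) (j : ℕ) (f : K n) :
    g * (eulerShift (k + d) ^ j) f = (eulerShift k ^ j) (g * f) := by
  induction j with
  | zero => simp
  | succ j ih =>
    rw [pow_succ', pow_succ', Module.End.mul_apply, Module.End.mul_apply, ← ih, eulerShift_apply,
      eulerShift_apply, Derivation.leibniz, smul_eq_mul, smul_eq_mul, hg]
    push_cast
    ring

/-! ### Homogeneous generators and Fermat's little theorem -/

theorem homogeneous_of_mem_closure (s : Set (K n)) (hs : ∀ f ∈ s, ∃ d : ℤ, euler n f = d * f)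
    {f : K n} (hf : f ∈ Submonoid.closure s) : ∃ d : ℤ, euler n f = d * f := by
  induction hf using Submonoid.closure_induction with
  | mem f hf => exact hs f hf
  | one => exact ⟨0, by simp⟩
  | mul f g _ _ hf hg =>
    obtain ⟨d, hd⟩ := hf
    obtain ⟨d', hd'⟩ := hg
    refine ⟨d + d', ?_⟩
    rw [Derivation.leibniz, hd, hd', smul_eq_mul, smul_eq_mul]
    push_cast
    ring

/-- On a ring generated by homogeneous elements, the operator `e + k` satisfies Fermat's little
theorem. -/
theorem eulerShift_pow_prime_sub_mem (s : Set (K n)) (hs : ∀ f ∈ s, ∃ d : ℤ, euler n f = d * f)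
    (p : ℕ) [Fact p.Prime] (k : ℤ) {f : K n} (hf : f ∈ Algebra.adjoin ℤ[X] s) :
    ∃ g ∈ Algebra.adjoin ℤ[X] s, (eulerShift k ^ p) f - eulerShift k f = p * g := by
  have hf' := hf
  rw [← Subalgebra.mem_toSubmodule, Algebra.adjoin_eq_span] at hf'
  induction hf' using Submodule.span_induction with
  | mem f hf' =>
    obtain ⟨d, hd⟩ := homogeneous_of_mem_closure s hs hf'
    have h2 : eulerShift k f = ((d + k : ℤ) : K n) * f := by
      rw [eulerShift_apply, hd]
      push_cast
      ring
    have h3 : ∀ j : ℕ, (eulerShift k ^ j) f = ((d + k : ℤ) : K n) ^ j * f := by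
      intro j
      induction j with
      | zero => simp
      | succ j ih =>
        rw [pow_succ, Module.End.mul_apply, h2, ← zsmul_eq_mul, map_zsmul, ih, zsmul_eq_mul]
        ring
    -- A monomial of weight d is an eigenvector with integer eigenvalue d + k. The quotient by p
    -- must stay in the subring, since p is invertible in `K n`.
    obtain ⟨c, hc⟩ := prime_dvd_intCast_pow_sub p (d + k)
    refine ⟨c * f, mul_mem (intCast_mem _ c) hf, ?_⟩
    have hc' := congrArg (Int.cast : ℤ → K n) hc
    rw [h2, h3, ← sub_mul, ← mul_assoc]
    congr 1
    exact_mod_cast hc'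
  | zero => exact ⟨0, zero_mem _, by simp⟩
  | add f g hf' hg' ihf ihg =>
    rw [← Algebra.adjoin_eq_span] at hf' hg'
    obtain ⟨f1, hf1, ef⟩ := ihf hf'
    obtain ⟨g1, hg1, eg⟩ := ihg hg'
    refine ⟨f1 + g1, add_mem hf1 hg1, ?_⟩
    rw [map_add, map_add, mul_add, ← ef, ← eg]
    ring
  | smul c f hf' ih =>
    rw [← Algebra.adjoin_eq_span] at hf'
    obtain ⟨f1, hf1, ef⟩ := ih hf'
    refine ⟨c • f1, Subalgebra.smul_mem _ hf1 c, ?_⟩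
    rw [map_smul, map_smul, ← smul_sub, ef, mul_smul_comm]

theorem eulerShift_mem (s : Set (K n)) (hs : ∀ f ∈ s, ∃ d : ℤ, euler n f = d * f) (k : ℤ) {f : K n}
    (hf : f ∈ Algebra.adjoin ℤ[X] s) : eulerShift k f ∈ Algebra.adjoin ℤ[X] s := by
  rw [eulerShift_apply]
  refine add_mem (derivation_mem_adjoin _ s (fun g hg => ?_) hf) (mul_mem (intCast_mem _ k) hf)
  obtain ⟨d, hd⟩ := hs g hg
  rw [hd]
  exact mul_mem (intCast_mem _ d) (Algebra.subset_adjoin hg)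

theorem homogeneous_inv {f : K n} {d : ℤ} (hf : euler n f = d * f) :
    euler n f⁻¹ = (-d : ℤ) * f⁻¹ := by
  rcases eq_or_ne f 0 with rfl | h0
  · simp
  · rw [Derivation.leibniz_inv, hf, smul_eq_mul]
    push_cast
    field_simp

theorem homogeneous_gensS {f : K n} (hf : f ∈ gensS n) : ∃ d : ℤ, euler n f = d * f := by
  rcases hf with (hf | ⟨i, rfl⟩) | ⟨i, j, hij, rfl⟩
  · rw [Set.mem_singleton_iff] at hf
    subst hf
    exact ⟨_, homogeneous_inv (d := 0) (by simp)⟩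
  · exact ⟨1, by simp⟩
  · exact ⟨_, homogeneous_inv (d := 1) (by simp)⟩

theorem homogeneous_poles {f : K n} (hf : f ∈ poles n) : ∃ d : ℤ, euler n f = d * f := by
  obtain ⟨i, rfl⟩ := hf
  exact ⟨_, homogeneous_inv (d := 1) (by simp)⟩

theorem homogeneous_x {f : K n} (hf : f ∈ ({x n} : Set (K n))) : ∃ d : ℤ, euler n f = d * f := by
  rw [Set.mem_singleton_iff] at hf
  subst hf
  exact ⟨1, by simp⟩

theorem homogeneous_gensOA : ∀ f ∈ gensS n ∪ {x n}, ∃ d : ℤ, euler n f = d * f :=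
  fun _ hf => hf.elim homogeneous_gensS homogeneous_x

theorem homogeneous_gensOV : ∀ f ∈ gensS n ∪ poles n, ∃ d : ℤ, euler n f = d * f :=
  fun _ hf => hf.elim homogeneous_gensS homogeneous_poles

theorem homogeneous_gensOU : ∀ f ∈ gensS n ∪ ({x n} ∪ poles n), ∃ d : ℤ, euler n f = d * f :=
  fun _ hf => hf.elim homogeneous_gensS fun hf => hf.elim homogeneous_x homogeneous_poles

theorem P_mul_eulerShift_pow (j : ℕ) (f : K n) :
    P n * (eulerShift 1 ^ j) f = (eulerShift (1 - n) ^ j) (P n * f) := by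
  have hPn : euler n (P n) = ((n : ℤ) : K n) * P n := by rw [euler_P]; simp
  simpa using mul_eulerShift_pow hPn (1 - n) j f

theorem x_mul_eulerShift_pow (j : ℕ) (f : K n) :
    x n * (eulerShift 1 ^ j) f = (eulerShift 0 ^ j) (x n * f) := by
  have hx : euler n (x n) = ((1 : ℤ) : K n) * x n := by simp
  simpa using mul_eulerShift_pow hx 0 j f

variable (n) in
/-- The Lie derivative along the Euler field on triples, without the contribution of `P^h`. -/
def cechEuler : Module.End ℤ[X] (K n × K n × K n) :=
  (eulerShift 1).prodMap ((eulerShift 1).prodMap (eulerShift 0))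

theorem cechEuler_pow_apply (j : ℕ) (w : K n × K n × K n) : (cechEuler n ^ j) w =
    ((eulerShift 1 ^ j) w.1, (eulerShift 1 ^ j) w.2.1, (eulerShift 0 ^ j) w.2.2) := by
  induction j with
  | zero => simp
  | succ j ih => simp only [pow_succ', Module.End.mul_apply, ih]; rfl

theorem natCast_ne_zero_of_prime (p : ℕ) [Fact p.Prime] : (p : K n) ≠ 0 :=
  Nat.cast_ne_zero.2 (Nat.Prime.ne_zero Fact.out)

/-- Fermat is applied to P a, b, x b and c, so that the quotients keep the pole conditions. Their
cocycle relation follows by cancelling p in `K n`. -/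
theorem cechEuler_pow_prime_sub_mem (p : ℕ) [Fact p.Prime] {w : K n × K n × K n}
    (hw : w ∈ cocycles n) :
    ∃ w' ∈ cocycles n, (cechEuler n ^ p) w - cechEuler n w = (p : ℤ[X]) • w' := by
  obtain ⟨a, b, c⟩ := w
  rw [mem_cocycles, mem_logFormsA, mem_logFormsV] at hw
  obtain ⟨ha, ⟨hb, hb'⟩, hc, habc⟩ := hw
  have hp := natCast_ne_zero_of_prime (n := n) p
  have hP := P_ne_zero (n := n)
  obtain ⟨a1, ha1, ea⟩ := eulerShift_pow_prime_sub_mem _ homogeneous_gensOA p (1 - n) ha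
  obtain ⟨b1, hb1, eb⟩ := eulerShift_pow_prime_sub_mem _ homogeneous_gensOV p 1 hb
  obtain ⟨b2, hb2, eb2⟩ := eulerShift_pow_prime_sub_mem _ homogeneous_gensOV p 0 hb'
  obtain ⟨c1, hc1, ec⟩ := eulerShift_pow_prime_sub_mem _ homogeneous_gensOU p 0 hc
  have ea' : (eulerShift 1 ^ p) a - eulerShift 1 a = p * (a1 / P n) := by
    have h2 := P_mul_eulerShift_pow 1 a
    rw [pow_one, pow_one] at h2
    rw [← P_mul_eulerShift_pow, ← h2, ← mul_sub] at ea
    field_simp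
    rw [← ea]
    ring
  have eb' : x n * b1 = b2 := by
    have h2 := x_mul_eulerShift_pow 1 b
    rw [pow_one, pow_one] at h2
    rw [← x_mul_eulerShift_pow, ← h2, ← mul_sub, eb] at eb2
    apply mul_left_cancel₀ hp
    rw [← eb2]
    ring
  refine ⟨(a1 / P n, b1, c1), ?_, ?_⟩
  · rw [mem_cocycles, mem_logFormsA, mem_logFormsV, mul_div_cancel₀ _ hP, eb']
    refine ⟨ha1, ⟨hb1, hb2⟩, hc1, mul_left_cancel₀ hp ?_⟩
    rw [mul_sub, ← eb, ← ea', ← nsmul_eq_mul (n := p) (a := relNabla n c1), ← map_nsmul,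
      nsmul_eq_mul, ← ec, map_sub, relNabla_eulerShift, relNabla_eulerShift_pow, ← habc, map_sub, map_sub]
    ring
  · rw [cechEuler_pow_apply]
    change ((eulerShift 1 ^ p) a - eulerShift 1 a, (eulerShift 1 ^ p) b - eulerShift 1 b,
      (eulerShift 0 ^ p) c - eulerShift 0 c) = _
    rw [ea', eb, ec, Nat.cast_smul_eq_nsmul]
    simp

/-! ### The Gauss–Manin connection along the Euler field -/

theorem lagr_eq_eval_basis (i : Fin n) :
    lagr i = (Lagrange.basis Finset.univ (z (n := n)) i).eval (x n) := by
  rw [Lagrange.basis, eval_prod, lagr]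
  refine Finset.prod_congr rfl fun j _ => ?_
  rw [Lagrange.basisDivisor]
  simp [div_eq_inv_mul]

/-- Lagrange interpolation of the polynomial x at the nodes z_i, exact because its degree 1 is less
than n. -/
theorem sum_z_mul_lagr (hn : 1 < n) : ∑ i, z i * lagr i = x n := by
  have h1 : (X : (K n)[X]) = Lagrange.interpolate Finset.univ (z (n := n)) z :=
    Lagrange.eq_interpolate_of_eval_eq _ z_injective.injOn (by simpa using hn) (by simp)
  have h2 := congrArg (eval (x n)) h1
  rw [eval_X, Lagrange.interpolate_apply, eval_finsetSum] at h2
  rw [h2]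
  refine Finset.sum_congr rfl fun i _ => ?_
  rw [eval_mul, eval_C, lagr_eq_eval_basis]

theorem sum_z_mul_dz (f : K n) : ∑ i, z i * dz i f = euler n f - x n * dx n f := by
  rw [euler_apply]
  ring

theorem sum_z_mul_liftA (hn : 1 < n) (f : K n) : ∑ i, z i * liftA i f = euler n f := by
  simp only [liftA, Derivation.add_apply, Derivation.smul_apply, smul_eq_mul, mul_add, ← mul_assoc,
    Finset.sum_add_distrib, ← Finset.sum_mul, sum_z_mul_lagr hn]
  exact (euler_apply f).symm

theorem sum_z_mul_dx_lagr (hn : 1 < n) : ∑ i, z i * dx n (lagr i) = 1 := by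
  rw [← dx_x, ← sum_z_mul_lagr hn, map_sum]
  simp [Derivation.leibniz]

/-- On 𝔸¹_S the lifts combine to the full Euler field. On V they miss x ∂/∂x, whose effect is ∇(x
b); in the third entry, ∇c = b - a turns x∇c + x a into x b. Together these form one Čech
differential. -/
theorem sum_cechZ_gmCech (hn : 1 < n) {w : K n × K n × K n} (hw : w ∈ cocycles n) :
    ∑ i, cechZ i (gmCech i w) =
      cechEuler n w + ((n : ℤ[X]) * X) • w - cechD n (0, x n * w.2.1) := by
  obtain ⟨a, b, c⟩ := w
  rw [mem_cocycles] at hw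
  have hP := P_ne_zero (n := n)
  have hh : ∀ f : K n, ((n : ℤ[X]) * X) • f = n * h n * f := by
    intro f
    rw [Algebra.smul_def, map_mul, map_natCast]
    rfl
  have h1 : ∑ i, z i * lieForm (liftA i) a = eulerShift 1 a + n * h n * a := by
    have e : ∀ i, z i * lieForm (liftA i) a = z i * liftA i a +
        (z i * liftA i (P n)) * (h n / P n * a) + z i * dx n (lagr i) * a := by
      intro i
      rw [lieForm_apply, cov_apply, liftA_x]
      ring
    simp only [e, Finset.sum_add_distrib, ← Finset.sum_mul, sum_z_mul_liftA hn,
      sum_z_mul_dx_lagr hn, euler_P, eulerShift_apply]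
    field_simp
    push_cast
    ring
  have h2 : ∀ f, ∑ i, z i * cov (dz i) f = eulerShift 0 f + n * h n * f - x n * relNabla n f := by
    intro f
    have e : ∀ i, z i * cov (dz i) f = z i * dz i f + (z i * dz i (P n)) * (h n / P n * f) := by
      intro i
      rw [cov_apply]
      ring
    simp only [e, Finset.sum_add_distrib, ← Finset.sum_mul, sum_z_mul_dz, euler_P, eulerShift_apply,
      relNabla_apply]
    field_simp
    push_cast
    ring
  have h3 : ∑ i, cechZ i (gmCech i (a, b, c)) = (∑ i, z i * lieForm (liftA i) a,
      ∑ i, z i * lieForm (dz i) b, ∑ i, z i * (cov (dz i) c - lagr i * a)) := by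
    simp only [Prod.ext_iff, Prod.fst_sum, Prod.snd_sum, cechZ_apply, gmCech_apply, and_self]
  have h4 : eulerShift 1 b = eulerShift 0 b + b := by
    simp [eulerShift_apply]
  have h5 : cechEuler n (a, b, c) = (eulerShift 1 a, eulerShift 1 b, eulerShift 0 c) := rfl
  simp only [h3, h1, h2, lieForm_dz_eq_cov, mul_sub, Finset.sum_sub_distrib, ← mul_assoc,
    ← Finset.sum_mul, sum_z_mul_lagr hn, cechD_apply, h5, h4, relNabla_mul, dx_x, map_zero,
    Prod.smul_mk, Prod.mk_add_mk, Prod.mk_sub_mk, hh, Prod.mk.injEq, sub_zero, true_and,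
    ← hw.2.2.2]
  constructor <;> ring

variable (n) in
/-- The Gauss–Manin connection along the Euler field `∑ z_i ∂/∂z_i`. -/
def eulerE : Module.End ℤ[X] (E n) := ∑ i, mulZ i * gaussManin i

theorem cechEuler_mem_cocycles {w : K n × K n × K n} (hw : w ∈ cocycles n) :
    cechEuler n w ∈ cocycles n := by
  obtain ⟨a, b, c⟩ := w
  rw [mem_cocycles, mem_logFormsA, mem_logFormsV] at hw
  obtain ⟨ha, ⟨hb, hb'⟩, hc, habc⟩ := hw
  have h1 := P_mul_eulerShift_pow 1 a
  have h2 := x_mul_eulerShift_pow 1 b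
  rw [pow_one, pow_one] at h1 h2
  change (eulerShift 1 a, eulerShift 1 b, eulerShift 0 c) ∈ _
  rw [mem_cocycles, mem_logFormsA, mem_logFormsV, h1, h2, relNabla_eulerShift, ← habc, map_sub]
  exact ⟨eulerShift_mem _ homogeneous_gensOA _ ha, ⟨eulerShift_mem _ homogeneous_gensOV _ hb,
    eulerShift_mem _ homogeneous_gensOV _ hb'⟩, eulerShift_mem _ homogeneous_gensOU _ hc, rfl⟩

theorem eulerE_toE (hn : 1 < n) (w : cocycles n) :
    (eulerE n - algebraMap ℤ[X] _ ((n : ℤ[X]) * X)) (toE n w) =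
      toE n ⟨cechEuler n w, cechEuler_mem_cocycles w.2⟩ := by
  have h1 : (eulerE n - algebraMap ℤ[X] _ ((n : ℤ[X]) * X)) (toE n w) =
      toE n ((∑ i, ⟨cechZ i (gmCech i w), cechZ_mem_cocycles i (gmCech_mem_cocycles i w.2)⟩) -
        ((n : ℤ[X]) * X) • w) := by
    rw [LinearMap.sub_apply, eulerE, LinearMap.sum_apply, Module.algebraMap_end_apply, map_sub,
      map_sum, map_smul]
    rfl
  rw [h1, toE_eq_iff]
  simp only [Submodule.coe_sub, Submodule.coe_sum, Submodule.coe_smul, sum_cechZ_gmCech hn w.2]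
  have h2 : cechEuler n w + ((n : ℤ[X]) * X) • (w : K n × K n × K n) -
      cechD n (0, x n * (w : K n × K n × K n).2.1) - ((n : ℤ[X]) * X) • (w : K n × K n × K n) -
      cechEuler n w = - cechD n (0, x n * (w : K n × K n × K n).2.1) := by abel
  rw [h2]
  -- The function x b is regular on V precisely because b dx is logarithmic at infinity.
  exact neg_mem ⟨(0, _), ⟨zero_mem _, w.2.2.1.2⟩, rfl⟩

/-- Stated integrally, as divisibility by p in E, so that it becomes an equality after tensoring
with a ring in which p = 0. -/
theorem eulerE_pow_prime (hn : 1 < n) (p : ℕ) [Fact p.Prime] (e : E n) :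
    ∃ e' : E n, ((eulerE n - algebraMap ℤ[X] _ ((n : ℤ[X]) * X)) ^ p) e -
      (eulerE n - algebraMap ℤ[X] _ ((n : ℤ[X]) * X)) e = (p : ℤ[X]) • e' := by
  have h1 : ∀ (j : ℕ) (w : cocycles n), ∃ h : (cechEuler n ^ j) w ∈ cocycles n,
      ((eulerE n - algebraMap ℤ[X] _ ((n : ℤ[X]) * X)) ^ j) (toE n w) = toE n ⟨_, h⟩ := by
    intro j w
    induction j with
    | zero => exact ⟨w.2, rfl⟩
    | succ j ih =>
      obtain ⟨h, e⟩ := ih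
      refine ⟨?_, ?_⟩
      · rw [pow_succ', Module.End.mul_apply]
        exact cechEuler_mem_cocycles h
      · rw [pow_succ', Module.End.mul_apply, e, eulerE_toE hn]
        simp only [pow_succ', Module.End.mul_apply]
  obtain ⟨w, rfl⟩ := toE_surjective e
  obtain ⟨hp, ep⟩ := h1 p w
  obtain ⟨w', hw', e⟩ := cechEuler_pow_prime_sub_mem p w.2
  refine ⟨toE n ⟨w', hw'⟩, ?_⟩
  rw [ep, eulerE_toE hn, ← map_sub, ← map_smul]
  congr 1
  exact Subtype.ext e

/-! ### The Euler operator on `E^♭` -/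

section Flat

variable (p : ℕ)

theorem natCast_baseFlat : (p : BaseFlat p) = 0 := by
  have h1 := congrArg (algebraMap (ZMod p)[X] (BaseFlat p)) (CharP.cast_eq_zero (ZMod p)[X] p)
  rwa [map_natCast, map_zero] at h1

theorem isUnit_algebraMap_baseFlat : IsUnit (algebraMap ℤ[X] (BaseFlat p) (X ^ p - X)) := by
  have h1 : algebraMap ℤ[X] (BaseFlat p) (X ^ p - X) =
      algebraMap (ZMod p)[X] (BaseFlat p) (X ^ p - X) := by
    change algebraMap (ZMod p)[X] (BaseFlat p) (mapRingHom _ (X ^ p - X)) = _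
    simp
  rw [h1]
  exact IsLocalization.Away.algebraMap_isUnit
    (S := Localization.Away (X ^ p - X : (ZMod p)[X])) (X ^ p - X : (ZMod p)[X])

theorem natCast_end_eFlat : (p : Module.End ℤ[X] (EFlat n p)) = 0 := by
  refine TensorProduct.ext' fun e b => ?_
  have h1 : ((p : ℕ) : Module.End ℤ[X] (TensorProduct ℤ[X] (E n) (BaseFlat p))) (e ⊗ₜ b) = 0 := by
    rw [Module.End.natCast_apply, ← TensorProduct.tmul_smul, nsmul_eq_mul, natCast_baseFlat,
      zero_mul, TensorProduct.tmul_zero]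
  exact h1

theorem isUnit_algebraMap_end_eFlat :
    IsUnit (algebraMap ℤ[X] (Module.End ℤ[X] (EFlat n p)) (X ^ p - X : ℤ[X])) := by
  obtain ⟨u, hu⟩ := isUnit_algebraMap_baseFlat p
  -- The inverse of h^p - h acts through the second tensor factor.
  let v : Module.End ℤ[X] (TensorProduct ℤ[X] (E n) (BaseFlat p)) :=
    (LinearMap.mulLeft ℤ[X] (↑u⁻¹ : BaseFlat p)).lTensor (E n)
  have h1 : algebraMap ℤ[X] (Module.End ℤ[X] (TensorProduct ℤ[X] (E n) (BaseFlat p)))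
      (X ^ p - X : ℤ[X]) * v = 1 := by
    refine TensorProduct.ext' fun e b => ?_
    rw [Module.End.mul_apply, Module.algebraMap_end_apply, LinearMap.lTensor_tmul,
      ← TensorProduct.tmul_smul, Algebra.smul_def, ← hu, LinearMap.mulLeft_apply,
      Units.mul_inv_cancel_left]
    rfl
  have h2 : IsUnit (algebraMap ℤ[X] (Module.End ℤ[X] (TensorProduct ℤ[X] (E n) (BaseFlat p)))
      (X ^ p - X : ℤ[X])) := ⟨⟨_, v, h1, (Algebra.commutes _ _).symm.trans h1⟩, rfl⟩
  exact h2

/-- Multiplication by `z_i` on `E^♭`. -/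
def mulZFlat (i : Fin n) : EFlat n p →ₗ[ℤ[X]] EFlat n p := (mulZ i).rTensor (BaseFlat p)

theorem nablaFlat_comm (i j : Fin n) (e : EFlat n p) :
    nablaFlat p i (nablaFlat p j e) = nablaFlat p j (nablaFlat p i e) := by
  have h1 : gaussManin i * gaussManin j = gaussManin j * gaussManin (n := n) i :=
    LinearMap.ext (gaussManin_comm i j)
  have h2 := congrArg (LinearMap.rTensor (BaseFlat p)) h1
  rw [LinearMap.rTensor_mul, LinearMap.rTensor_mul] at h2
  exact LinearMap.congr_fun h2 e

theorem nablaFlat_mulZFlat (i j : Fin n) (e : EFlat n p) :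
    nablaFlat p i (mulZFlat p j e) = mulZFlat p j (nablaFlat p i e) + if i = j then e else 0 := by
  have h1 : gaussManin i * mulZ j = mulZ j * gaussManin i +
      if i = j then (1 : Module.End ℤ[X] (E n)) else 0 := by
    refine LinearMap.ext fun e => ?_
    have := gaussManin_mulZ i j e
    rw [Module.End.mul_apply, this, LinearMap.add_apply, Module.End.mul_apply]
    split_ifs <;> rfl
  have h2 := congrArg (LinearMap.rTensor (BaseFlat p)) h1
  rw [LinearMap.rTensor_add, LinearMap.rTensor_mul, LinearMap.rTensor_mul] at h2
  have h3 : (if i = j then (1 : Module.End ℤ[X] (E n)) else 0).rTensor (BaseFlat p) =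
      if i = j then 1 else 0 := by
    split_ifs
    · exact LinearMap.rTensor_id _ _
    · exact LinearMap.rTensor_zero _
  rw [h3] at h2
  have h4 : nablaFlat p i * mulZFlat p j = mulZFlat p j * nablaFlat p i +
      if i = j then (1 : Module.End ℤ[X] (EFlat n p)) else 0 := h2
  refine (LinearMap.congr_fun h4 e).trans ?_
  rw [LinearMap.add_apply]
  split_ifs <;> rfl

variable (n) in
/-- The connection on `E^♭` along the Euler field `∑ z_i ∂/∂z_i`. -/
def eulerFlat : Module.End ℤ[X] (EFlat n p) := (eulerE n).rTensor (BaseFlat p)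

theorem eulerFlat_apply (e : EFlat n p) :
    eulerFlat n p e = ∑ i, mulZFlat p i (nablaFlat p i e) := by
  have h1 : (eulerE n).rTensor (BaseFlat p) =
      ∑ i, (mulZ i).rTensor (BaseFlat p) * (gaussManin i).rTensor (BaseFlat p) := by
    rw [eulerE, ← LinearMap.coe_rTensorHom, map_sum]
    simp only [LinearMap.coe_rTensorHom, LinearMap.rTensor_mul]
  exact (LinearMap.congr_fun h1 e).trans (LinearMap.sum_apply _ _ _)

theorem deRhamD_apply (m : ℕ) (ω : Forms n p m) (I : Fin (m + 1) ↪o Fin n) :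
    deRhamD n p m ω I = ∑ k : Fin (m + 1), (-1 : ℤ) ^ (k : ℕ) •
      nablaFlat p (I k) (ω ((Fin.succAboveOrderEmb k).trans I)) := by
  rw [deRhamD, LinearMap.pi_apply, LinearMap.sum_apply]
  rfl

variable [Fact p.Prime]

theorem eulerFlat_sub_pow_prime (hn : 1 < n) :
    (eulerFlat n p - algebraMap ℤ[X] _ ((n : ℤ[X]) * X)) ^ p =
      eulerFlat n p - algebraMap ℤ[X] _ ((n : ℤ[X]) * X) := by
  set θ : Module.End ℤ[X] (E n) := eulerE n - algebraMap ℤ[X] _ ((n : ℤ[X]) * X) with hθ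
  have h1 : eulerFlat n p - algebraMap ℤ[X] _ ((n : ℤ[X]) * X) =
      (θ.rTensor (BaseFlat p) : Module.End ℤ[X] (TensorProduct ℤ[X] (E n) (BaseFlat p))) := by
    rw [hθ, LinearMap.rTensor_sub, eulerFlat, Module.algebraMap_end_eq_smul_id,
      Module.algebraMap_end_eq_smul_id, LinearMap.rTensor_smul, LinearMap.rTensor_id]
    rfl
  have h2 : (θ.rTensor (BaseFlat p) : Module.End ℤ[X] (TensorProduct ℤ[X] (E n) (BaseFlat p))) ^ p =
      θ.rTensor (BaseFlat p) := by
    rw [LinearMap.rTensor_pow]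
    refine TensorProduct.ext' fun e b => ?_
    obtain ⟨e', he'⟩ := eulerE_pow_prime hn p e
    rw [LinearMap.rTensor_tmul, LinearMap.rTensor_tmul, ← sub_eq_zero, ← TensorProduct.sub_tmul,
      he', TensorProduct.smul_tmul, Nat.cast_smul_eq_nsmul, nsmul_eq_mul, natCast_baseFlat,
      zero_mul, TensorProduct.tmul_zero]
  rw [h1]
  exact h2

/-- The `p`-th power of the Euler operator on `E^♭`. -/
theorem eulerFlat_pow_prime_sub (hn : 1 < n) :
    eulerFlat n p ^ p - eulerFlat n p = n * algebraMap ℤ[X] _ (X ^ p - X) := by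
  set c := algebraMap ℤ[X] (Module.End ℤ[X] (EFlat n p)) ((n : ℤ[X]) * X) with hc
  have hp := natCast_end_eFlat (n := n) p
  have hcomm : Commute (eulerFlat n p - c) c := (Algebra.commute_algebraMap_right _ _)
  have h1 := hcomm.add_pow_prime_of_natCast_eq_zero hp
  rw [sub_add_cancel, eulerFlat_sub_pow_prime p hn] at h1
  -- Here n^p = n because p = 0 in the endomorphism ring.
  have h2 : c ^ p = n * algebraMap ℤ[X] _ (X ^ p) := by
    have h3 := intCast_pow_prime hp (n : ℤ)
    push_cast at h3
    rw [hc, map_mul, map_natCast, (Nat.cast_commute _ _).mul_pow, h3, map_pow]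
  rw [h1, h2, map_sub, mul_sub, map_mul, map_natCast]
  abel

theorem bijective_eulerFlat_add (hn : 1 < n) (hpn : ¬ p ∣ n) (k : ℕ) : Function.Bijective
    fun e : EFlat n p => ∑ i, mulZFlat p i (nablaFlat p i e) + k • e := by
  have hp := natCast_end_eFlat (n := n) p
  have h1 : IsUnit (eulerFlat n p ^ p - eulerFlat n p) := by
    rw [eulerFlat_pow_prime_sub p hn]
    exact (isUnit_natCast_of_not_dvd hp hpn).mul (isUnit_algebraMap_end_eFlat p)
  have h2 := (Module.End.isUnit_iff _).1 (isUnit_add_natCast hp h1 k)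
  convert h2 using 2 with e
  rw [LinearMap.add_apply, eulerFlat_apply, Module.End.natCast_apply]

/-! ### Vanishing of the cohomology -/

theorem eq_zero_of_nablaFlat_eq_zero (hn : 1 < n) (hpn : ¬ p ∣ n) (e : EFlat n p)
    (he : ∀ i, nablaFlat p i e = 0) : e = 0 := by
  refine (bijective_eulerFlat_add p hn hpn 0).1 ?_
  simp [he]

theorem ker_deRhamD_le_exactForms (hn : 1 < n) (hpn : ¬ p ∣ n) (m : ℕ) :
    LinearMap.ker (deRhamD n p m) ≤ exactForms n p m := by
  intro ω hω
  rw [LinearMap.mem_ker] at hω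
  have hω' := fun I => (deRhamD_apply p m ω I).symm.trans (congrFun hω I)
  cases m with
  | zero =>
    rw [exactForms, Submodule.mem_bot]
    funext J
    refine eq_zero_of_nablaFlat_eq_zero p hn hpn _ fun i => ?_
    -- The coefficient of dz_i in dω; a family of length one is vacuously increasing.
    have h1 := hω' (OrderEmbedding.ofStrictMono (fun _ : Fin (0 + 1) => i)
      fun a b hab => absurd hab (by omega))
    rw [Fin.sum_univ_one, Fin.val_zero, pow_zero, one_smul] at h1
    rwa [show J = _ from DFunLike.ext _ _ fun k => k.elim0]
  | succ m =>
    obtain ⟨η, hη⟩ := exists_primitive (fun i => (nablaFlat p i).toAddMonoidHom)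
      (fun i => (mulZFlat p i).toAddMonoidHom) (fun i j => nablaFlat_mulZFlat p i j)
      (fun i j => nablaFlat_comm p i j) (bijective_eulerFlat_add p hn hpn) ω hω'
    refine ⟨η, funext fun I => ?_⟩
    rw [deRhamD_apply]
    exact hη I

end Flat

end LogLocalSystem

end

theorem mainTheorem5 (n : ℕ) (hn : 1 < n) (p : ℕ) [Fact p.Prime] (hpn : ¬ p ∣ n) :
    (∀ m : ℕ, Subsingleton (LogLocalSystem.DeRhamCohomology n p m)) ∧
      ∀ e : LogLocalSystem.EFlat n p,
        (∀ i : Fin n, LogLocalSystem.nablaFlat p i e = 0) → e = 0 := by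
  refine ⟨fun m => ?_, LogLocalSystem.eq_zero_of_nablaFlat_eq_zero p hn hpn⟩
  rw [Submodule.Quotient.subsingleton_iff, Submodule.submoduleOf, Submodule.comap_subtype_eq_top]
  exact LogLocalSystem.ker_deRhamD_le_exactForms p hn hpn m
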